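/- **Model.** Let $G=(V,E)$ be a finite directed graph with $n=|V|\ge 1$. In the triggering model every node $v$ carries a distribution $D_v$ on the subsets of its in-neighbours; triggering sets $T_v\sim D_v$ are drawn independently. The nodes of a seed set $S$ are active at time $0$, a node $v$ becomes active at time $t\ge 1$ if some node of $T_v$ is active at time $t-1$, and active nodes stay active; $\sigma(S)$ is the expected number of nodes that are eventually active. Each node has an activation function $h_v:\mathbb R_+^d\to[0,1]$ that is, on $\mathbb R_+^d$, monotone, DR-submodular ($h_v(x+\delta e_i)-h_v(x)\ge h_v(y+\delta e_i)-h_v(y)$ for all $x\le y$, all $i$ and all $\delta>0$), $L_h$-Lipschitz with $L_h>0$, and $\beta_h$-smooth (differentiable with $\beta_h$-Lipschitz gradient), all with respect to the Euclidean norm. Put $$g(x)=\sum_{S\subseteq V}\sigma(S)\prod_{u\in S}h_u(x)\prod_{v\notin S}(1-h_v(x)).$$ Let $\mathcal D\subseteq\mathbb R_+^d$ be convex, $c:\mathcal D\to\mathbb R$ convex and $L_c$-Lipschitz, $k\ge 0$ a budget, $\lambda\ge 0$, $s(x)=\lambda(k-c(x))$ and $\mathcal P=\{x\in\mathcal D: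 c(x)\le k\}$. Assume that $\mathcal P$ is compact, that $\Delta$ is an upper bound of its diameter, that $x^{(0)}\in\mathcal P$, and that $\mathrm{OPT}_{g+s}:=\max_{x\in\mathcal P}(g+s)(x)\ge 1$. **RR sets.** A random RR set is obtained by choosing a root $v\in V$ uniformly, drawing all triggering sets independently, and taking all nodes that can reach $v$ in the graph with edges $\{(w,u): w\in T_u\}$. For a list $\mathcal R$ of $\theta$ RR sets put $\hat g_{\mathcal R}(x)=\frac n\theta\sum_{R\in\mathcal R}\bigl(1-\prod_{v\in R}(1-h_v(x))\bigr)$, $\nu^{(j)}(\mathcal R)=\frac1\theta\sum_{R\in\mathcal R}|R|^j$ and $\hat\beta_{\mathcal R}=\nu^{(1)}(\mathcal R)\,n\beta_h+\nu^{(2)}(\mathcal R)\,nL_h^2$. **Proximal gradient $\mathcal A(\mathcal R,e)$.** With $\eta=1/\hat\beta_{\mathcal R}$ and $T=\lceil 3\hat\beta_{\mathcal R}\Delta^2/(4e)\rceil$, starting from $x^{(0)}$, iterate $$x^{(t+1)}=\operatorname*{argmin}_{y\in\mathcal P}\Bigl(-\eta s(y)+\tfrac12\bigl\|x^{(t)}+\eta\nabla\hat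 g_{\mathcal R}(x^{(t)})-y\bigr\|_2^2\Bigr),$$ and return a best iterate, for the objective $\hat g_{\mathcal R}+s$, among $x^{(0)},\dots,x^{(T)}$. **ProxGrad-RIS.** Let $\varepsilon,\ell>0$, $\alpha=\frac12$, $\alpha'=\alpha-\varepsilon/3$, $\varepsilon'=\sqrt2\,\varepsilon/3$, $L_1=L_2=n^2L_h+\lambda L_c$, and let $\mathcal N(\mathcal P,r)$ be the least size of a finite set that has a point within distance $r$ of every point of $\mathcal P$. 1. Start with $\mathit{LB}=1$, $\theta_0=0$ and no RR sets. For $i=1,2,\dots,\lfloor\log_2(n+\lambda k)-1\rfloor$: let $x_i=(n+\lambda k)/2^i$ and $$\theta_i=\left\lceil n\Bigl(2+\tfrac23\varepsilon'\Bigr)\frac{\ln\mathcal N\bigl(\mathcal P,\frac{\varepsilon/3}{L_2}x_i\bigr)+\ell\ln n+\ln2+\ln\log_2(n+\lambda k)}{\varepsilon'^2x_i}\right\rceil;$$ add $\theta_i-\theta_{i-1}$ new independent RR sets to obtain $\mathcal R_i$; let $y_i=\mathcal A(\mathcal R_i,\varepsilon x_i/3)$; if $(\hat g_{\mathcal R_i}+s)(y_i)\ge(1+\varepsilon'+\varepsilon/3)x_i$,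 set $\mathit{LB}=(\hat g_{\mathcal R_i}+s)(y_i)/(1+\varepsilon'+\varepsilon/3)$ and leave the loop. 2. Let $$\theta^{(1)}=\frac{8n\ln(4n^\ell)}{\mathit{LB}\,(\alpha-\varepsilon/3)^2\varepsilon^2/9},\qquad \theta^{(2)}=\frac{2\alpha' n\ln\bigl(4n^\ell\,\mathcal N(\mathcal P,\frac{\varepsilon/3}{L_1+L_2}\mathit{LB})\bigr)}{\bigl(\varepsilon/3-\frac14(\alpha-\varepsilon/3)^2\varepsilon/3\bigr)^2\mathit{LB}},$$ generate a fresh list $\mathcal R$ of $\lceil\max\{\theta^{(1)},\theta^{(2)}\}\rceil$ independent RR sets, and return $x=\mathcal A(\mathcal R,\varepsilon\,\mathit{LB})$. (A quotient with denominator $0$ is read as $0$; this matters only for large $\varepsilon$.) **Theorem.** For all $\varepsilon,\ell>0$, with probability at least $1-\frac1{n^\ell}$, ProxGrad-RIS returns a strategy mix $x\in\mathcal P$ with $(g+s)(x)\ge\bigl(\frac12-\varepsilon\bigr)\mathrm{OPT}_{g+s}$. -/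

import Mathlib

open scoped NNReal ENNReal

/-- Strategy mixes live in `ℝ^d` with the Euclidean norm. -/
abbrev Strategy (d : ℕ) : Type := EuclideanSpace ℝ (Fin d)

/-- The non-negative orthant `ℝ_+^d`. -/
def nonnegOrthant (d : ℕ) : Set (Strategy d) := {x | ∀ i, 0 ≤ x i}

/-- Coordinate-wise monotonicity of `f` on `S`. -/
def IsMonotoneOn {d : ℕ} (S : Set (Strategy d)) (f : Strategy d → ℝ) : Prop :=
  ∀ x ∈ S, ∀ y ∈ S, (∀ i, x i ≤ y i) → f x ≤ f y

/-- DR-submodularity of `f` on `S`: the marginal return along every coordinate diminishes. -/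
def IsDRSubmodularOn {d : ℕ} (S : Set (Strategy d)) (f : Strategy d → ℝ) : Prop :=
  ∀ x ∈ S, ∀ y ∈ S, (∀ i, x i ≤ y i) → ∀ (i : Fin d) (δ : ℝ), 0 < δ →
    x + EuclideanSpace.single i δ ∈ S → y + EuclideanSpace.single i δ ∈ S →
      f (y + EuclideanSpace.single i δ) - f y ≤ f (x + EuclideanSpace.single i δ) - f x

/-- `β`-smoothness of `f` on `S`: `f` has gradients everywhere on `S` (taken within `S`, hence
one-sided at boundary points), and the gradient is `β`-Lipschitz on `S`. -/
def IsSmoothOn {d : ℕ} (β : ℝ≥0) (S : Set (Strategy d)) (f : Strategy d → ℝ) : Prop :=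
  DifferentiableOn ℝ f S ∧ LipschitzOnWith β (gradientWithin f S) S

/-- A triggering model on a directed graph with node set `V`: every node `v` carries a
distribution on the subsets of its in-neighbours. -/
structure TriggeringModel (V : Type*) where
  /-- the social network -/
  graph : Digraph V
  /-- the distribution of the triggering set of a node -/
  trig : V → PMF (Finset V)
  /-- triggering sets consist of in-neighbours -/
  trig_subset : ∀ v, ∀ T ∈ (trig v).support, ∀ u ∈ T, graph.Adj u v

namespace TriggeringModel

variable {V : Type*} [Fintype V] [DecidableEq V]

/-- The joint law of the triggering sets `(T_v)_v`, sampled independently. -/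
noncomputable def triggerLaw (M : TriggeringModel V) : PMF (V → Finset V) :=
  PMF.ofFintype (fun T => ∏ v, M.trig v (T v)) (by
    have h1 : ∀ v, ∑ S : Finset V, M.trig v S = 1 := fun v => by
      rw [← tsum_fintype (L := .unconditional _)]
      exact (M.trig v).tsum_coe
    have h2 := Finset.prod_univ_sum (fun _ : V => (Finset.univ : Finset (Finset V)))
      (fun v S => M.trig v S)
    rw [Fintype.piFinset_univ] at h2
    rw [← h2]
    simp [h1])

/-- The set of nodes active at time `t`, for triggering sets `T` and seed set `S`. -/
def activeAt (T : V → Finset V) (S : Finset V) : ℕ → Set V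
  | 0 => ↑S
  | t + 1 => activeAt T S t ∪ {v | ∃ u ∈ T v, u ∈ activeAt T S t}

/-- The set of nodes that are eventually active. -/
def finalActive (T : V → Finset V) (S : Finset V) : Set V := {v | ∃ t, v ∈ activeAt T S t}

/-- The influence spread `σ(S)`: the expected number of finally activated nodes. -/
noncomputable def spread (M : TriggeringModel V) (S : Finset V) : ℝ :=
  ∑ T : V → Finset V, (M.triggerLaw T).toReal * ((finalActive T S).ncard : ℝ)

open Classical in
/-- The reverse reachable set of the root `v`: all nodes that can reach `v` in the live-edge graph
with edge set `{(w, u) | w ∈ T u}`. -/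
noncomputable def reverseReachable (T : V → Finset V) (v : V) : Finset V :=
  Finset.univ.filter fun u => Relation.ReflTransGen (fun w u' => w ∈ T u') u v

/-- The law of a random RR set: uniform root, independent triggering sets. -/
noncomputable def rrLaw [Nonempty V] (M : TriggeringModel V) : PMF (Finset V) :=
  (PMF.uniformOfFintype V).bind fun v => M.triggerLaw.map fun T => reverseReachable T v

/-- `m` independent RR sets. -/
noncomputable def rrSamples [Nonempty V] (M : TriggeringModel V) : ℕ → PMF (List (Finset V))
  | 0 => PMF.pure []
  | m + 1 => M.rrLaw.bind fun R => (rrSamples M m).map fun l => R :: l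

end TriggeringModel

/-- The data of an instance of continuous influence maximization with budget saving. -/
structure CIMBS (V : Type*) (d : ℕ) where
  /-- social network with its triggering model -/
  model : TriggeringModel V
  /-- strategy activation functions -/
  h : V → Strategy d → ℝ
  /-- strategy domain `𝒟` -/
  domain : Set (Strategy d)
  /-- cost function -/
  c : Strategy d → ℝ
  /-- budget -/
  k : ℝ
  /-- balance parameter `λ` -/
  lam : ℝ

/-- The remaining inputs of the algorithm. -/
structure ProxGradInput (d : ℕ) where
  /-- approximation parameter `ε` -/
  eps : ℝ
  /-- confidence parameter `ℓ` -/
  ell : ℝ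
  /-- Lipschitz constant of the activation functions -/
  Lh : ℝ≥0
  /-- smoothness constant of the activation functions -/
  βh : ℝ≥0
  /-- Lipschitz constant of the cost function -/
  Lc : ℝ≥0
  /-- upper bound on the diameter of the feasible set -/
  Δ : ℝ
  /-- starting point of the proximal gradient iteration -/
  x0 : Strategy d

namespace CIMBS

variable {V : Type*} [Fintype V] [DecidableEq V] {d : ℕ}

/-- The feasible set `𝒫 = {x ∈ 𝒟 | c(x) ≤ k}`. -/
def feasible (I : CIMBS V d) : Set (Strategy d) := {x | x ∈ I.domain ∧ I.c x ≤ I.k}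

/-- The influence spread `g(x)` of a strategy mix. -/
noncomputable def g (I : CIMBS V d) (x : Strategy d) : ℝ :=
  ∑ S : Finset V, I.model.spread S * (∏ u ∈ S, I.h u x) * ∏ v ∈ Sᶜ, (1 - I.h v x)

/-- The budget saving part `s(x) = λ (k - c(x))`. -/
def s (I : CIMBS V d) (x : Strategy d) : ℝ := I.lam * (I.k - I.c x)

/-- `OPT_{g+s}`, the optimal value of the problem. -/
noncomputable def opt (I : CIMBS V d) : ℝ := sSup ((fun x => I.g x + I.s x) '' I.feasible)

/-- The RR-set estimator `ĝ_R(x) = (n/θ) ∑_{R} (1 - ∏_{v ∈ R} (1 - h_v(x)))` of `g`. -/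
noncomputable def gHat (I : CIMBS V d) (Rs : List (Finset V)) (x : Strategy d) : ℝ :=
  (Fintype.card V : ℝ) / (Rs.length : ℝ) *
    (Rs.map fun R => 1 - ∏ v ∈ R, (1 - I.h v x)).sum

/-- The gradient of `h_v`, on `ℝ_+^d`. -/
noncomputable def gradH (I : CIMBS V d) (v : V) (x : Strategy d) : Strategy d :=
  gradientWithin (I.h v) (nonnegOrthant d) x

/-- The exact gradient of the estimator,
`(n/θ) ∑_{R} ∑_{v' ∈ R} (∏_{v ∈ R, v ≠ v'} (1 - h_v(x))) ∇h_{v'}(x)`. -/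
noncomputable def gradGHat (I : CIMBS V d) (Rs : List (Finset V)) (x : Strategy d) : Strategy d :=
  ((Fintype.card V : ℝ) / (Rs.length : ℝ)) •
    (Rs.map fun R => ∑ v' ∈ R, (∏ v ∈ R.erase v', (1 - I.h v x)) • I.gradH v' x).sum

/-- The empirical moment `ν^{(j)}(R) = ∑_R |R|^j / θ`. -/
noncomputable def nu (j : ℕ) (Rs : List (Finset V)) : ℝ :=
  (Rs.map fun R => (R.card : ℝ) ^ j).sum / (Rs.length : ℝ)

/-- The proximal step `prox_{-η s}(x) = argmin_{y ∈ 𝒫} (-η s(y) + ½ ‖x - y‖²)`. -/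
noncomputable def prox (I : CIMBS V d) (η : ℝ) (x : Strategy d) : Strategy d :=
  Classical.epsilon fun y =>
    y ∈ I.feasible ∧ IsMinOn (fun z => -η * I.s z + 1 / 2 * ‖x - z‖ ^ 2) I.feasible y

/-- The smoothness constant `ν^{(1)}(R) n β_h + ν^{(2)}(R) n L_h²` of the estimator. -/
noncomputable def betaHat (p : ProxGradInput d) (Rs : List (Finset V)) : ℝ :=
  nu 1 Rs * (Fintype.card V : ℝ) * p.βh + nu 2 Rs * (Fintype.card V : ℝ) * (p.Lh : ℝ) ^ 2

/-- The proximal gradient iteration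
`x^{(t+1)} = prox_{-η s}(x^{(t)} + η ∇ĝ_R(x^{(t)}))` with step size `η`, started at `x0`. -/
noncomputable def iterate (I : CIMBS V d) (Rs : List (Finset V)) (η : ℝ) (x0 : Strategy d) :
    ℕ → Strategy d
  | 0 => x0
  | t + 1 => I.prox η (iterate I Rs η x0 t + η • I.gradGHat Rs (iterate I Rs η x0 t))

/-- The number `T = 3 (ν^{(1)} n β_h + ν^{(2)} n L_h²) Δ² / (4 err)` of steps, rounded up. -/
noncomputable def numSteps (p : ProxGradInput d) (Rs : List (Finset V)) (err : ℝ) : ℕ :=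
  ⌈3 * betaHat p Rs * p.Δ ^ 2 / (4 * err)⌉₊

/-- The proximal gradient algorithm on the objective `ĝ_R + s` with error parameter `err`: step size
`1 / (ν^{(1)} n β_h + ν^{(2)} n L_h²)`, and the best of the iterates `x^{(0)}, …, x^{(T)}` is
returned. -/
noncomputable def proxGrad (I : CIMBS V d) (p : ProxGradInput d) (Rs : List (Finset V))
    (err : ℝ) : Strategy d :=
  I.iterate Rs (1 / betaHat p Rs) p.x0
    (Classical.choose
      (Finset.exists_max_image (Finset.range (numSteps p Rs err + 1))
        (fun t => I.gHat Rs (I.iterate Rs (1 / betaHat p Rs) p.x0 t) +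
          I.s (I.iterate Rs (1 / betaHat p Rs) p.x0 t))
        Finset.nonempty_range_add_one))

/-- The Lipschitz bound `L₁ = L₂ = n² L_h + λ L_c` that is given to the sampling procedure. -/
noncomputable def lip (I : CIMBS V d) (p : ProxGradInput d) : ℝ :=
  (Fintype.card V : ℝ) ^ 2 * p.Lh + I.lam * p.Lc

/-- The covering number `𝒩(𝒫, r)`: the least size of a finite set whose points come within
distance `r` of every point of `𝒫`. -/
noncomputable def covNum (I : CIMBS V d) (r : ℝ) : ℝ :=
  ((Metric.externalCoveringNumber r.toNNReal I.feasible).toNat : ℝ)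

/-- `ε' = √2 ε / 3`. -/
noncomputable def epsPrime (p : ProxGradInput d) : ℝ := Real.sqrt 2 * p.eps / 3

/-- The guess `x_i = (n + λ k) / 2^i` of the optimal value. -/
noncomputable def guess (I : CIMBS V d) (i : ℕ) : ℝ :=
  ((Fintype.card V : ℝ) + I.lam * I.k) / 2 ^ i

/-- The number `θ_i` of RR sets available in round `i`; `θ_0 = 0`. -/
noncomputable def theta (I : CIMBS V d) (p : ProxGradInput d) (i : ℕ) : ℕ :=
  if i = 0 then 0 else
    ⌈(Fintype.card V : ℝ) * (2 + 2 / 3 * epsPrime p) *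
      (Real.log (I.covNum (p.eps / 3 / I.lip p * I.guess i)) +
        p.ell * Real.log (Fintype.card V : ℝ) + Real.log 2 +
        Real.log (Real.logb 2 ((Fintype.card V : ℝ) + I.lam * I.k))) /
      (epsPrime p ^ 2 * I.guess i)⌉₊

/-- The number `⌊log₂ (n + λ k) - 1⌋` of rounds of the sampling loop. -/
noncomputable def rounds (I : CIMBS V d) : ℕ :=
  ⌊Real.logb 2 ((Fintype.card V : ℝ) + I.lam * I.k) - 1⌋₊

open Classical in
/-- The loop of the sampling procedure, which returns the estimate `LB`. First argument: the number
of rounds left; second: the index `i` of the next round; third: the RR sets `R_{i-1}` generated so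
far. -/
noncomputable def lbLoop [Nonempty V] (I : CIMBS V d) (p : ProxGradInput d) :
    ℕ → ℕ → List (Finset V) → PMF ℝ
  | 0, _, _ => PMF.pure 1
  | r + 1, i, Rs =>
    (I.model.rrSamples (I.theta p i - I.theta p (i - 1))).bind fun new =>
      let Ri := new ++ Rs
      let y := I.proxGrad p Ri (p.eps * I.guess i / 3)
      let val := I.gHat Ri y + I.s y
      if (1 + epsPrime p + p.eps / 3) * I.guess i ≤ val then
        PMF.pure (val / (1 + epsPrime p + p.eps / 3))
      else lbLoop I p r (i + 1) Ri

/-- `θ^{(1)} = 8 n ln(4 n^ℓ) / (LB (α - ε/3)² ε²/9)`. -/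
noncomputable def theta1 (V : Type*) [Fintype V] (p : ProxGradInput d) (α LB : ℝ) : ℝ :=
  8 * (Fintype.card V : ℝ) * Real.log (4 * (Fintype.card V : ℝ) ^ p.ell) /
    (LB * (α - p.eps / 3) ^ 2 * (p.eps ^ 2 / 9))

/-- `θ^{(2)} = 2 α' n ln(4 n^ℓ 𝒩(𝒫, (ε/3) LB / (L₁ + L₂))) / ((ε/3 - ¼ (α - ε/3)² ε/3)² LB)`, where
`α' = α - ε/3`. -/
noncomputable def theta2 (I : CIMBS V d) (p : ProxGradInput d) (α LB : ℝ) : ℝ :=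
  2 * (α - p.eps / 3) * (Fintype.card V : ℝ) *
      Real.log (4 * (Fintype.card V : ℝ) ^ p.ell *
        I.covNum (p.eps / 3 / (I.lip p + I.lip p) * LB)) /
    ((p.eps / 3 - 1 / 4 * (α - p.eps / 3) ^ 2 * (p.eps / 3)) ^ 2 * LB)

/-- The sampling procedure with `α = 1/2`: it returns the estimate `LB` together with freshly
generated RR sets, `max {θ^{(1)}, θ^{(2)}}` (rounded up) in number. -/
noncomputable def sampling [Nonempty V] (I : CIMBS V d) (p : ProxGradInput d) :
    PMF (List (Finset V) × ℝ) :=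
  (I.lbLoop p I.rounds 1 []).bind fun LB =>
    (I.model.rrSamples ⌈max (theta1 V p (1 / 2) LB) (I.theta2 p (1 / 2) LB)⌉₊).map
      fun Rs => (Rs, LB)

/-- ProxGrad-RIS: the law of the strategy mix that is returned. -/
noncomputable def proxGradRIS [Nonempty V] (I : CIMBS V d) (p : ProxGradInput d) :
    PMF (Strategy d) :=
  (I.sampling p).map fun RL => I.proxGrad p RL.1 (p.eps * RL.2)

end CIMBS

/-! A seed set activates `v` exactly when it meets the RR set rooted at `v`. Hence `g x` is `n`
times the mean of `coverage x R` over a random RR set `R` (`g_eq_card_mul_rrMean`), and `gHat` is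
`n` times an average of independent copies of a `[0, 1]`-valued variable. Bernstein-type tails hold
at each fixed `x`. A union bound over a net extends upper tails to all feasible points, because
`gHat + s` and `g + s` are both `lip p`-Lipschitz there.

Optimisation. Passing from `x` to `y` through the join and the meet gives `gHat y - 2 * gHat x ≤
⟪∇gHat x, y - x⟫` (`gHat_sub_two_mul_le`), which stands in for concavity and costs the factor `1/2`.
With F = `gHat + s` and β = `betaHat`, a proximal step from `x` to `x'` yields F(y) ≤ F(x) + F(x') +
β/2 (‖y - x‖² - ‖y - x'‖²) and also increases F by at least β/2 ‖x - x'‖². `gap_le_of_telescoping`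
combines the two into a final gap to F(y)/2 of at most 5/18 of the error parameter
(`half_sub_le_proxGrad`).

Sampling. For `LB ≤ OPT` only overestimation matters: unless some feasible point has an estimate
above `(1 + ε' + ε/3) * max OPT x_i`, a passed test in round `i` certifies `LB ≤ OPT`. The quality
of the optimiser is irrelevant here, as is any lower bound on `LB` beyond positivity. A union bound
over the rounds costs `1/(2n^ℓ)` (`lbLoop_le`).

Final phase. Write u = ε/3. With failure probability at most `1/(2n^ℓ)`, the estimate at an optimal
point is not too low, and at no net point with small `g` is it too high. If the returned point were
worse than `(1/2 - ε) OPT`, a nearby net point would have small `g`, hence a small estimate, which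
contradicts the guarantee of the optimiser on the sample (`rrSamples_proxGrad_le`). -/

set_option linter.unusedSectionVars false

open Filter Topology

/-! ### Exponential inequalities behind the tail bounds -/

namespace Real

/-- The difference of the two sides vanishes at 0 and has derivative `exp x * (exp (-x) - 1 + x) ≥
0`. A third of it is the derivative that occurs in the next lemma. -/
theorem two_sub_mul_exp_sub_one_le {s : ℝ} (hs : 0 ≤ s) : (2 - s) * (exp s - 1) ≤ 2 * s := by
  have key : MonotoneOn (fun s : ℝ => 2 * s - (2 - s) * (exp s - 1)) (Set.Ici 0) := by
    have hd : ∀ x : ℝ, HasDerivAt (fun s : ℝ => 2 * s - (2 - s) * (exp s - 1))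
        (1 - exp x + x * exp x) x := fun x => by
      have := ((hasDerivAt_id x).const_mul 2).sub
        (((hasDerivAt_id x).const_sub 2).mul ((Real.hasDerivAt_exp x).sub_const 1))
      refine this.congr_deriv ?_
      dsimp
      ring
    refine monotoneOn_of_deriv_nonneg (convex_Ici 0)
      (fun x _ => (hd x).continuousAt.continuousWithinAt)
      (fun x _ => (hd x).differentiableAt.differentiableWithinAt) fun x _ => ?_
    rw [(hd x).deriv]
    have h1 : -x + 1 ≤ exp (-x) := add_one_le_exp (-x)
    have h2 : exp (-x) * exp x = 1 := by rw [← exp_add]; simp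
    nlinarith [exp_pos x]
  have := key (Set.mem_Ici.2 le_rfl) (Set.mem_Ici.2 hs) hs
  simp at this
  linarith

/-- This is the quadratic bound that gives Bernstein's denominator `2μ + 2t/3`. After multiplication
by `1 - s/3`, both sides agree at 0 and their difference is monotone. -/
theorem exp_le_one_add_add_sq_div {s : ℝ} (hs : 0 ≤ s) (hs3 : s < 3) :
    exp s ≤ 1 + s + s ^ 2 / (2 * (1 - s / 3)) := by
  have key : MonotoneOn (fun s : ℝ => s ^ 2 / 2 - (1 - s / 3) * (exp s - 1 - s)) (Set.Ici 0) := by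
    have hd : ∀ x : ℝ, HasDerivAt (fun s : ℝ => s ^ 2 / 2 - (1 - s / 3) * (exp s - 1 - s))
        (1 / 3 * (2 * x - (2 - x) * (exp x - 1))) x := fun x => by
      have := (((hasDerivAt_id x).pow 2).div_const 2).sub
        ((((hasDerivAt_id x).div_const 3).const_sub 1).mul
          (((Real.hasDerivAt_exp x).sub_const 1).sub (hasDerivAt_id x)))
      refine this.congr_deriv ?_
      dsimp
      ring
    refine monotoneOn_of_deriv_nonneg (convex_Ici 0)
      (fun x _ => (hd x).continuousAt.continuousWithinAt)
      (fun x _ => (hd x).differentiableAt.differentiableWithinAt) fun x hx => ?_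
    rw [(hd x).deriv]
    have := two_sub_mul_exp_sub_one_le (interior_subset hx : (0 : ℝ) ≤ x)
    linarith
  have h := key (Set.mem_Ici.2 le_rfl) (Set.mem_Ici.2 hs) hs
  have hpos : 0 < 1 - s / 3 := by linarith
  have h2 : exp s - 1 - s ≤ s ^ 2 / 2 / (1 - s / 3) := by
    rw [le_div_iff₀ hpos]
    simp at h
    linarith
  have h3 : s ^ 2 / (2 * (1 - s / 3)) = s ^ 2 / 2 / (1 - s / 3) := by rw [div_div]
  linarith

theorem exp_neg_le_one_sub_add_sq_div {s : ℝ} (hs : 0 ≤ s) : exp (-s) ≤ 1 - s + s ^ 2 / 2 := by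
  have h1 := quadratic_le_exp_of_nonneg hs
  have h2 : exp (-s) * exp s = 1 := by rw [← exp_add]; simp
  have h3 : 0 < 1 - s + s ^ 2 / 2 := by nlinarith [sq_nonneg (s - 1)]
  by_contra hcon
  push Not at hcon
  -- The product on the left equals `1 + s ^ 4 / 4`, while the one on the right is 1.
  have h4 : (1 - s + s ^ 2 / 2) * (1 + s + s ^ 2 / 2) < exp (-s) * exp s := by
    have : 0 < 1 + s + s ^ 2 / 2 := by positivity
    nlinarith [exp_pos (-s)]
  nlinarith [sq_nonneg (s ^ 2)]

/-- The exponential is below its chord on `[0, 1]`. -/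
theorem exp_mul_le_one_add_mul {s x : ℝ} (hx0 : 0 ≤ x) (hx1 : x ≤ 1) :
    exp (s * x) ≤ 1 + x * (exp s - 1) := by
  have := convexOn_exp.2 (Set.mem_univ 0) (Set.mem_univ s) (sub_nonneg.2 hx1) hx0 (by ring)
  simp only [smul_eq_mul, mul_zero, zero_add, exp_zero, mul_one] at this
  rw [mul_comm s x]
  linarith

end Real

/-! ### Expectations and probabilities under a discrete law -/

namespace PMF

variable {α β : Type*}

/-- The expectation of a non-negative function. -/
noncomputable def expect (p : PMF α) (f : α → ℝ≥0∞) : ℝ≥0∞ := ∑' a, p a * f a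

theorem expect_pure (a : α) (f : α → ℝ≥0∞) : (PMF.pure a).expect f = f a := by
  classical
  rw [expect, tsum_eq_single a]
  · simp
  · intro b hb
    simp [PMF.pure_apply, hb]

theorem expect_bind (p : PMF α) (q : α → PMF β) (f : β → ℝ≥0∞) :
    (p.bind q).expect f = p.expect fun a => (q a).expect f := by
  simp only [expect, PMF.bind_apply, ← ENNReal.tsum_mul_right, ← ENNReal.tsum_mul_left]
  rw [ENNReal.tsum_comm]
  simp only [mul_assoc]

theorem expect_map (p : PMF α) (g : α → β) (f : β → ℝ≥0∞) :
    (p.map g).expect f = p.expect fun a => f (g a) := by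
  rw [PMF.map, expect_bind]
  simp [expect_pure]

theorem expect_mono (p : PMF α) {f g : α → ℝ≥0∞} (h : ∀ a ∈ p.support, f a ≤ g a) :
    p.expect f ≤ p.expect g := by
  refine ENNReal.tsum_le_tsum fun a => ?_
  by_cases ha : a ∈ p.support
  · exact mul_le_mul_right (h a ha) _
  · simp [(p.apply_eq_zero_iff a).2 ha]

theorem expect_add (p : PMF α) (f g : α → ℝ≥0∞) :
    (p.expect fun a => f a + g a) = p.expect f + p.expect g := by
  simp only [expect, mul_add, ENNReal.tsum_add]

theorem expect_const_mul (p : PMF α) (c : ℝ≥0∞) (f : α → ℝ≥0∞) :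
    (p.expect fun a => c * f a) = c * p.expect f := by
  simp only [expect, ← ENNReal.tsum_mul_left]
  exact tsum_congr fun a => by ring

theorem expect_const (p : PMF α) (c : ℝ≥0∞) : (p.expect fun _ => c) = c := by
  simp only [expect, ENNReal.tsum_mul_right, p.tsum_coe, one_mul]

theorem toOuterMeasure_eq_expect (p : PMF α) (s : Set α) :
    p.toOuterMeasure s = p.expect (s.indicator 1) := by
  rw [toOuterMeasure_apply, expect]
  refine tsum_congr fun a => ?_
  by_cases h : a ∈ s <;> simp [h]

theorem toOuterMeasure_bind_eq_expect (p : PMF α) (q : α → PMF β) (s : Set β) :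
    (p.bind q).toOuterMeasure s = p.expect fun a => (q a).toOuterMeasure s := by
  rw [toOuterMeasure_eq_expect, expect_bind]
  simp only [← toOuterMeasure_eq_expect]

theorem toOuterMeasure_le_expect (p : PMF α) {s : Set α} {f : α → ℝ≥0∞}
    (h : ∀ a ∈ s, 1 ≤ f a) : p.toOuterMeasure s ≤ p.expect f := by
  rw [toOuterMeasure_eq_expect]
  refine expect_mono _ fun a _ => ?_
  by_cases ha : a ∈ s
  · simpa [ha] using h a ha
  · simp [ha]

theorem toOuterMeasure_le_one (p : PMF α) (s : Set α) : p.toOuterMeasure s ≤ 1 := by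
  calc p.toOuterMeasure s ≤ p.expect fun _ => 1 := p.toOuterMeasure_le_expect fun _ _ => le_rfl
    _ = 1 := p.expect_const 1

theorem toOuterMeasure_add_compl (p : PMF α) (s : Set α) :
    p.toOuterMeasure s + p.toOuterMeasure sᶜ = 1 := by
  rw [toOuterMeasure_eq_expect, toOuterMeasure_eq_expect, ← expect_add, ← p.expect_const 1]
  congr 1
  funext a
  by_cases h : a ∈ s <;> simp [h]

end PMF

/-! ### Chernoff bounds for independent RR sets -/

namespace TriggeringModel

variable {V : Type*} [Fintype V] [DecidableEq V] [Nonempty V] (M : TriggeringModel V)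

theorem expect_rrSamples_prod (φ : Finset V → ℝ≥0∞) (m : ℕ) :
    (M.rrSamples m).expect (fun l => (l.map φ).prod) = (M.rrLaw.expect φ) ^ m := by
  induction m with
  | zero => simp [rrSamples, PMF.expect_pure]
  | succ m ih =>
    simp only [rrSamples, PMF.expect_bind, PMF.expect_map, List.map_cons, List.prod_cons,
      PMF.expect_const_mul, ih]
    rw [pow_succ, ← PMF.expect_const_mul]
    simp only [mul_comm]

/-- The mean of a real function of a random RR set. -/
noncomputable def rrMean (X : Finset V → ℝ) : ℝ := ∑ R, (M.rrLaw R).toReal * X R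

theorem sum_rrLaw_toReal : ∑ R, (M.rrLaw R).toReal = 1 := by
  rw [← ENNReal.toReal_sum fun R _ => M.rrLaw.apply_ne_top R, ← tsum_fintype (L := .unconditional _),
    M.rrLaw.tsum_coe, ENNReal.toReal_one]

theorem expect_rrLaw_ofReal {X : Finset V → ℝ} (hX : ∀ R, 0 ≤ X R) :
    M.rrLaw.expect (fun R => ENNReal.ofReal (X R)) = ENNReal.ofReal (M.rrMean X) := by
  rw [PMF.expect, tsum_fintype, rrMean, ENNReal.ofReal_sum_of_nonneg fun R _ =>
    mul_nonneg ENNReal.toReal_nonneg (hX R)]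
  refine Finset.sum_congr rfl fun R _ => ?_
  rw [ENNReal.ofReal_mul ENNReal.toReal_nonneg, ENNReal.ofReal_toReal (M.rrLaw.apply_ne_top R)]

theorem rrMean_nonneg {X : Finset V → ℝ} (hX : ∀ R, 0 ≤ X R) : 0 ≤ M.rrMean X :=
  Finset.sum_nonneg fun R _ => mul_nonneg ENNReal.toReal_nonneg (hX R)

/-- By convexity, the moment generating function of a `[0, 1]`-valued variable is at most that of a
Bernoulli variable with the same mean, and hence that of a Poisson variable. -/
theorem rrMean_exp_le {X : Finset V → ℝ} (hX0 : ∀ R, 0 ≤ X R) (hX1 : ∀ R, X R ≤ 1) (s : ℝ) :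
    M.rrMean (fun R => Real.exp (s * X R)) ≤ Real.exp (M.rrMean X * (Real.exp s - 1)) := by
  calc M.rrMean (fun R => Real.exp (s * X R))
      ≤ ∑ R, (M.rrLaw R).toReal * (1 + X R * (Real.exp s - 1)) :=
        Finset.sum_le_sum fun R _ => mul_le_mul_of_nonneg_left
          (Real.exp_mul_le_one_add_mul (hX0 R) (hX1 R)) ENNReal.toReal_nonneg
    _ = M.rrMean X * (Real.exp s - 1) + 1 := by
        simp only [mul_add, mul_one, Finset.sum_add_distrib, M.sum_rrLaw_toReal, rrMean,
          Finset.sum_mul, mul_assoc]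
        ring
    _ ≤ _ := Real.add_one_le_exp _

/-- The exponential Markov bound for a sum over independent RR sets. -/
theorem rrSamples_chernoff {X : Finset V → ℝ} (hX0 : ∀ R, 0 ≤ X R) (hX1 : ∀ R, X R ≤ 1)
    (m : ℕ) (s c : ℝ) :
    (M.rrSamples m).toOuterMeasure {l | c ≤ s * (l.map X).sum} ≤
      ENNReal.ofReal (Real.exp (m * (M.rrMean X * (Real.exp s - 1)) - c)) := by
  have hprod : ∀ l : List (Finset V),
      (l.map fun R => ENNReal.ofReal (Real.exp (s * X R))).prod =
        ENNReal.ofReal (Real.exp (s * (l.map X).sum)) := fun l => by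
    induction l with
    | nil => simp
    | cons R l ih =>
      simp only [List.map_cons, List.prod_cons, List.sum_cons, ih]
      rw [← ENNReal.ofReal_mul (Real.exp_nonneg _), ← Real.exp_add, mul_add]
  calc (M.rrSamples m).toOuterMeasure {l | c ≤ s * (l.map X).sum}
      ≤ (M.rrSamples m).expect fun l => ENNReal.ofReal (Real.exp (-c)) *
          (l.map fun R => ENNReal.ofReal (Real.exp (s * X R))).prod := by
        refine PMF.toOuterMeasure_le_expect _ fun l hl => ?_
        rw [hprod, ← ENNReal.ofReal_mul (Real.exp_nonneg _), ← Real.exp_add, ← ENNReal.ofReal_one]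
        refine ENNReal.ofReal_le_ofReal (Real.one_le_exp ?_)
        have : c ≤ s * (l.map X).sum := hl
        linarith
    _ = ENNReal.ofReal (Real.exp (-c)) *
          ENNReal.ofReal (M.rrMean fun R => Real.exp (s * X R)) ^ m := by
        rw [PMF.expect_const_mul, M.expect_rrSamples_prod,
          M.expect_rrLaw_ofReal fun R => Real.exp_nonneg _]
    _ ≤ ENNReal.ofReal (Real.exp (-c)) *
          ENNReal.ofReal (Real.exp (M.rrMean X * (Real.exp s - 1))) ^ m := by
        gcongr
        exact M.rrMean_exp_le hX0 hX1 s
    _ = _ := by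
        rw [← ENNReal.ofReal_pow (Real.exp_nonneg _), ← Real.exp_nat_mul,
          ← ENNReal.ofReal_mul (Real.exp_nonneg _), ← Real.exp_add]
        congr 2
        ring

theorem rrSamples_upper_tail {X : Finset V → ℝ} (hX0 : ∀ R, 0 ≤ X R) (hX1 : ∀ R, X R ≤ 1)
    (m : ℕ) {μ t : ℝ} (hμ : M.rrMean X ≤ μ) (hμ0 : 0 < μ) (ht : 0 ≤ t) :
    (M.rrSamples m).toOuterMeasure {l | m * (M.rrMean X + t) ≤ (l.map X).sum} ≤
      ENNReal.ofReal (Real.exp (-(m * t ^ 2 / (2 * μ + 2 / 3 * t)))) := by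
  -- With this `s` the quadratic term of the exponent is `s * t / 2`, half of the linear gain `s *
  -- t`, and `1 - s / 3 = μ / (μ + t / 3)` stays positive.
  set s : ℝ := t / (μ + t / 3) with hs
  have hden : 0 < μ + t / 3 := by positivity
  have hs0 : 0 ≤ s := by positivity
  have hs3 : s < 3 := by rw [hs, div_lt_iff₀ hden]; linarith
  calc (M.rrSamples m).toOuterMeasure {l | m * (M.rrMean X + t) ≤ (l.map X).sum}
      ≤ (M.rrSamples m).toOuterMeasure {l | s * (m * (M.rrMean X + t)) ≤ s * (l.map X).sum} :=
        MeasureTheory.measure_mono fun l (hl : _ ≤ _) => mul_le_mul_of_nonneg_left hl hs0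
    _ ≤ _ := M.rrSamples_chernoff hX0 hX1 m s _
    _ ≤ _ := by
        refine ENNReal.ofReal_le_ofReal (Real.exp_le_exp.2 ?_)
        have h1 := Real.exp_le_one_add_add_sq_div hs0 hs3
        have h2 : s ^ 2 / (2 * (1 - s / 3)) * μ = s * t / 2 := by
          have : 1 - s / 3 = μ / (μ + t / 3) := by rw [hs]; field_simp; ring
          rw [this, hs]
          field_simp
        have h3 : t ^ 2 / (2 * μ + 2 / 3 * t) = s * t / 2 := by
          rw [hs]
          field_simp
        have h4 : 0 ≤ s ^ 2 / (2 * (1 - s / 3)) := by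
          have : 0 ≤ 1 - s / 3 := by linarith
          positivity
        have h5 : M.rrMean X * (Real.exp s - 1) - s * (M.rrMean X + t) ≤ -(s * t / 2) := by
          nlinarith [M.rrMean_nonneg hX0, mul_le_mul_of_nonneg_left hμ h4,
            mul_le_mul_of_nonneg_left h1 (M.rrMean_nonneg hX0)]
        rw [mul_div_assoc, h3]
        nlinarith [mul_le_mul_of_nonneg_left h5 (Nat.cast_nonneg (α := ℝ) m)]

theorem rrSamples_lower_tail {X : Finset V → ℝ} (hX0 : ∀ R, 0 ≤ X R) (hX1 : ∀ R, X R ≤ 1)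
    (m : ℕ) {μ t : ℝ} (hμ : M.rrMean X ≤ μ) (hμ0 : 0 < μ) (ht : 0 ≤ t) :
    (M.rrSamples m).toOuterMeasure {l | (l.map X).sum ≤ m * (M.rrMean X - t)} ≤
      ENNReal.ofReal (Real.exp (-(m * t ^ 2 / (2 * μ)))) := by
  -- This is the minimiser of `-s * t + s ^ 2 * μ / 2`.
  set s : ℝ := t / μ with hs
  have hs0 : 0 ≤ s := by positivity
  calc (M.rrSamples m).toOuterMeasure {l | (l.map X).sum ≤ m * (M.rrMean X - t)}
      ≤ (M.rrSamples m).toOuterMeasure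
          {l | -s * (m * (M.rrMean X - t)) ≤ -s * (l.map X).sum} :=
        MeasureTheory.measure_mono fun l (hl : _ ≤ _) =>
          mul_le_mul_of_nonpos_left hl (neg_nonpos.2 hs0)
    _ ≤ _ := M.rrSamples_chernoff hX0 hX1 m (-s) _
    _ ≤ _ := by
        refine ENNReal.ofReal_le_ofReal (Real.exp_le_exp.2 ?_)
        have h1 := Real.exp_neg_le_one_sub_add_sq_div hs0
        have h2 : s * μ = t := by rw [hs]; field_simp
        have h3 : t ^ 2 / (2 * μ) = s * t / 2 := by rw [hs]; field_simp
        have h5 : M.rrMean X * (Real.exp (-s) - 1) + s * (M.rrMean X - t) ≤ -(s * t / 2) := by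
          nlinarith [mul_le_mul_of_nonneg_left h1 (M.rrMean_nonneg hX0),
            mul_le_mul_of_nonneg_left hμ (sq_nonneg s)]
        rw [mul_div_assoc, h3]
        nlinarith [mul_le_mul_of_nonneg_left h5 (Nat.cast_nonneg (α := ℝ) m)]

/-- The loop extends its old list by new RR sets; this identifies the law of the extended list. -/
theorem rrSamples_add (a b : ℕ) :
    M.rrSamples (a + b) =
      (M.rrSamples a).bind fun l => (M.rrSamples b).map fun new => l ++ new := by
  induction a with
  | zero =>
    simp only [Nat.zero_add, rrSamples, PMF.pure_bind, List.nil_append]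
    exact (PMF.map_id _).symm
  | succ a ih =>
    rw [Nat.succ_add]
    simp only [rrSamples, ih, PMF.bind_bind, PMF.map_bind, PMF.bind_map, PMF.map_comp,
      Function.comp_def, List.cons_append]

theorem length_of_mem_support_rrSamples {m : ℕ} {l : List (Finset V)}
    (hl : l ∈ (M.rrSamples m).support) : l.length = m := by
  induction m generalizing l with
  | zero => simp_all [rrSamples]
  | succ m ih =>
    simp only [rrSamples, PMF.mem_support_bind_iff, PMF.mem_support_map_iff] at hl
    obtain ⟨R, -, l', hl', rfl⟩ := hl
    simp [ih hl']

theorem nonempty_of_mem_support_rrLaw {R : Finset V} (hR : R ∈ M.rrLaw.support) :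
    R.Nonempty := by
  simp only [rrLaw, PMF.mem_support_bind_iff, PMF.mem_support_map_iff] at hR
  obtain ⟨v, -, T, -, rfl⟩ := hR
  exact ⟨v, by simp [reverseReachable, Relation.ReflTransGen.refl]⟩

theorem nonempty_of_mem_of_mem_support_rrSamples {m : ℕ} {l : List (Finset V)}
    (hl : l ∈ (M.rrSamples m).support) {R : Finset V} (hR : R ∈ l) : R.Nonempty := by
  induction m generalizing l with
  | zero => simp_all [rrSamples]
  | succ m ih =>
    simp only [rrSamples, PMF.mem_support_bind_iff, PMF.mem_support_map_iff] at hl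
    obtain ⟨R', hR', l', hl', rfl⟩ := hl
    rcases List.mem_cons.1 hR with rfl | h
    · exact M.nonempty_of_mem_support_rrLaw hR'
    · exact ih hl' h

end TriggeringModel

/-! ### Duality between influence spread and RR sets -/

namespace TriggeringModel

variable {V : Type*} [Fintype V]

theorem mem_finalActive_iff (T : V → Finset V) (S : Finset V) (v : V) :
    v ∈ finalActive T S ↔ ¬ Disjoint S (reverseReachable T v) := by
  rw [Finset.not_disjoint_iff]
  simp only [reverseReachable, Finset.mem_filter, Finset.mem_univ, true_and]
  constructor
  · rintro ⟨t, ht⟩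
    induction t generalizing v with
    | zero => exact ⟨v, ht, .refl⟩
    | succ t ih =>
      rcases ht with ht | ⟨u, hu, hut⟩
      · exact ih v ht
      · obtain ⟨w, hw, hwu⟩ := ih u hut
        exact ⟨w, hw, hwu.tail hu⟩
  · rintro ⟨u, hu, huv⟩
    induction huv with
    | refl => exact ⟨0, hu⟩
    | tail _ h ih =>
      obtain ⟨t, ht⟩ := ih
      exact ⟨t + 1, Or.inr ⟨_, h, ht⟩⟩

theorem ncard_finalActive [DecidableEq V] (T : V → Finset V) (S : Finset V) :
    ((finalActive T S).ncard : ℝ) =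
      ∑ v, if Disjoint S (reverseReachable T v) then (0 : ℝ) else 1 := by
  have h : finalActive T S = ↑(Finset.univ.filter fun v => ¬ Disjoint S (reverseReachable T v)) := by
    ext v
    simp [mem_finalActive_iff]
  rw [h, Set.ncard_coe_finset, Finset.card_filter]
  push_cast
  simp only [ite_not]

/-- The factor `n` cancels the uniform choice of the root and leaves a sum over all roots, averaged
over the triggering sets. -/
theorem card_mul_rrMean [DecidableEq V] [Nonempty V] (M : TriggeringModel V) (X : Finset V → ℝ) :
    (Fintype.card V : ℝ) * M.rrMean X =
      ∑ T, (M.triggerLaw T).toReal * ∑ v, X (reverseReachable T v) := by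
  have hcard : (Fintype.card V : ℝ) ≠ 0 := by simp
  have hR : ∀ R, (M.rrLaw R).toReal =
      (Fintype.card V : ℝ)⁻¹ * ∑ v, ∑ T, if R = reverseReachable T v
        then (M.triggerLaw T).toReal else 0 := fun R => by
    simp only [rrLaw, PMF.bind_apply, PMF.map_apply, tsum_fintype, PMF.uniformOfFintype_apply]
    rw [ENNReal.toReal_sum, Finset.mul_sum]
    · refine Finset.sum_congr rfl fun v _ => ?_
      rw [ENNReal.toReal_mul, ENNReal.toReal_inv, ENNReal.toReal_natCast, ENNReal.toReal_sum]
      · congr 1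
        refine Finset.sum_congr rfl fun T _ => ?_
        split_ifs <;> simp
      · intro T _
        split_ifs
        · exact PMF.apply_ne_top _ _
        · simp
    · intro v _
      refine ENNReal.mul_ne_top (by simp) (ENNReal.sum_ne_top.2 fun T _ => ?_)
      split_ifs
      · exact PMF.apply_ne_top _ _
      · simp
  simp only [rrMean, hR, Finset.mul_sum, Finset.sum_mul, mul_assoc]
  rw [Finset.sum_comm]
  simp only [mul_inv_cancel_left₀ hcard]
  rw [Finset.sum_congr rfl fun v _ => Finset.sum_comm]
  rw [Finset.sum_comm]
  refine Finset.sum_congr rfl fun T _ => Finset.sum_congr rfl fun v _ => ?_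
  simp

end TriggeringModel

/-- Sum over all subsets weighted by independent inclusion, restricted to those that avoid `R`. -/
theorem sum_prod_mul_prod_compl_disjoint {V : Type*} [Fintype V] [DecidableEq V] (q : V → ℝ)
    (R : Finset V) :
    ∑ S : Finset V, (if Disjoint S R then (0 : ℝ) else 1) *
      ((∏ u ∈ S, q u) * ∏ v ∈ Sᶜ, (1 - q v)) = 1 - ∏ v ∈ R, (1 - q v) := by
  have h1 : ∑ S : Finset V, (∏ u ∈ S, q u) * ∏ v ∈ Sᶜ, (1 - q v) = 1 := by
    have := Finset.prod_add q (fun v => 1 - q v) Finset.univ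
    simp only [add_sub_cancel, Finset.prod_const_one, Finset.powerset_univ] at this
    simpa [Finset.compl_eq_univ_sdiff] using this.symm
  have h2 : ∑ S : Finset V, (if Disjoint S R then (1 : ℝ) else 0) *
      ((∏ u ∈ S, q u) * ∏ v ∈ Sᶜ, (1 - q v)) = ∏ v ∈ R, (1 - q v) := by
    -- Replacing `q` by zero on `R` kills exactly the subsets that meet `R`, so the expanded product
    -- is the sum over those disjoint from `R`.
    have := Finset.prod_add (fun v => if v ∈ R then 0 else q v) (fun v => 1 - q v) Finset.univ
    simp only [Finset.powerset_univ, ← Finset.compl_eq_univ_sdiff] at this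
    rw [← Finset.prod_subset (Finset.subset_univ R)] at this
    · rw [Finset.prod_congr rfl (g := fun v => 1 - q v) (fun v hv => by simp [hv])] at this
      rw [this]
      refine Finset.sum_congr rfl fun S _ => ?_
      rw [← mul_assoc]
      congr 1
      split_ifs with h
      · rw [one_mul]
        exact Finset.prod_congr rfl fun v hv => by simp [Finset.disjoint_left.1 h hv]
      · obtain ⟨v, hv, hvR⟩ := Finset.not_disjoint_iff.1 h
        rw [zero_mul, Finset.prod_eq_zero hv (by simp [hvR])]
    · intro v _ hv
      simp [hv]
  refine eq_sub_of_add_eq ?_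
  rw [← h2, ← Finset.sum_add_distrib]
  refine Eq.trans (Finset.sum_congr rfl fun S _ => ?_) h1
  split_ifs <;> ring

namespace CIMBS

variable {V : Type*} [Fintype V] [DecidableEq V] {d : ℕ}

/-- The probability that the strategy mix `x` activates a node of `R` as a seed. -/
noncomputable def coverage (I : CIMBS V d) (x : Strategy d) (R : Finset V) : ℝ :=
  1 - ∏ v ∈ R, (1 - I.h v x)

theorem g_eq_card_mul_rrMean [Nonempty V] (I : CIMBS V d) (x : Strategy d) :
    I.g x = (Fintype.card V : ℝ) * I.model.rrMean (I.coverage x) := by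
  rw [TriggeringModel.card_mul_rrMean]
  simp only [g, TriggeringModel.spread, TriggeringModel.ncard_finalActive, coverage,
    ← sum_prod_mul_prod_compl_disjoint (fun v => I.h v x), Finset.sum_mul, mul_assoc]
  rw [Finset.sum_comm]
  refine Finset.sum_congr rfl fun T _ => ?_
  rw [← Finset.mul_sum, Finset.sum_comm]

end CIMBS

/-! ### First-order bounds for products -/

section Products

theorem abs_prod_sub_prod_le_sum {ι : Type*} {a b : ι → ℝ} (R : Finset ι)
    (ha : ∀ i, a i ∈ Set.Icc (0 : ℝ) 1) (hb : ∀ i, b i ∈ Set.Icc (0 : ℝ) 1) :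
    |∏ i ∈ R, a i - ∏ i ∈ R, b i| ≤ ∑ i ∈ R, |a i - b i| := by
  classical
  induction R using Finset.induction_on with
  | empty => simp
  | insert v R hv ih =>
    rw [Finset.prod_insert hv, Finset.prod_insert hv, Finset.sum_insert hv]
    have h1 : a v * ∏ i ∈ R, a i - b v * ∏ i ∈ R, b i =
        (a v - b v) * ∏ i ∈ R, a i + b v * (∏ i ∈ R, a i - ∏ i ∈ R, b i) := by ring
    rw [h1]
    refine (abs_add_le _ _).trans (add_le_add ?_ ?_)
    · rw [abs_mul]
      refine mul_le_of_le_one_right (abs_nonneg _) ?_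
      rw [abs_of_nonneg (Finset.prod_nonneg fun i _ => (ha i).1)]
      exact Finset.prod_le_one (fun i _ => (ha i).1) fun i _ => (ha i).2
    · rw [abs_mul, abs_of_nonneg (hb v).1]
      exact (mul_le_of_le_one_left (abs_nonneg _) (hb v).2).trans ih

variable {ι : Type*} [DecidableEq ι]

/-- When the factors drop from `a` to `b` one at a time, each drop `a i - b i` is multiplied by a
mixture of `a`- and `b`-factors, which is at most the pure `a`-product. For `a = 1 - h` this
expresses the diminishing returns of coverage under an increase of `h`. -/
theorem prod_sub_prod_le_sum_erase {a b : ι → ℝ} (R : Finset ι) (hb : ∀ i ∈ R, 0 ≤ b i)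
    (hab : ∀ i ∈ R, b i ≤ a i) :
    ∏ i ∈ R, a i - ∏ i ∈ R, b i ≤ ∑ i ∈ R, (∏ j ∈ R.erase i, a j) * (a i - b i) := by
  induction R using Finset.induction_on with
  | empty => simp
  | insert v R hv ih =>
    simp only [Finset.mem_insert, forall_eq_or_imp] at hb hab
    have key := ih hb.2 hab.2
    have hAB : ∏ i ∈ R, b i ≤ ∏ i ∈ R, a i := Finset.prod_le_prod hb.2 hab.2
    rw [Finset.prod_insert hv, Finset.prod_insert hv, Finset.sum_insert hv,
      Finset.erase_insert hv]
    have hs : ∑ i ∈ R, (∏ j ∈ (insert v R).erase i, a j) * (a i - b i) =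
        a v * ∑ i ∈ R, (∏ j ∈ R.erase i, a j) * (a i - b i) := by
      rw [Finset.mul_sum]
      refine Finset.sum_congr rfl fun i hi => ?_
      rw [Finset.erase_insert_of_ne (by rintro rfl; exact hv hi),
        Finset.prod_insert (by simp [hv]), mul_assoc]
    rw [hs]
    nlinarith [mul_le_mul_of_nonneg_left key (hb.1.trans hab.1),
      mul_nonneg (sub_nonneg.2 hab.1) (sub_nonneg.2 hAB)]

/-- The mirror image: when the factors rise from `a` to `c`, the other factors are at least their
`a`-values, so the gain is at least its first-order part. -/
theorem sum_erase_le_prod_sub_prod {a c : ι → ℝ} (R : Finset ι) (ha : ∀ i ∈ R, 0 ≤ a i)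
    (hac : ∀ i ∈ R, a i ≤ c i) :
    ∑ i ∈ R, (∏ j ∈ R.erase i, a j) * (c i - a i) ≤ ∏ i ∈ R, c i - ∏ i ∈ R, a i := by
  induction R using Finset.induction_on with
  | empty => simp
  | insert v R hv ih =>
    simp only [Finset.mem_insert, forall_eq_or_imp] at ha hac
    have key := ih ha.2 hac.2
    have hAC : ∏ i ∈ R, a i ≤ ∏ i ∈ R, c i := Finset.prod_le_prod ha.2 hac.2
    rw [Finset.prod_insert hv, Finset.prod_insert hv, Finset.sum_insert hv,
      Finset.erase_insert hv]
    have hs : ∑ i ∈ R, (∏ j ∈ (insert v R).erase i, a j) * (c i - a i) =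
        a v * ∑ i ∈ R, (∏ j ∈ R.erase i, a j) * (c i - a i) := by
      rw [Finset.mul_sum]
      refine Finset.sum_congr rfl fun i hi => ?_
      rw [Finset.erase_insert_of_ne (by rintro rfl; exact hv hi),
        Finset.prod_insert (by simp [hv]), mul_assoc]
    rw [hs]
    nlinarith [mul_le_mul_of_nonneg_left key ha.1,
      mul_nonneg (sub_nonneg.2 hac.1) (sub_nonneg.2 hAC)]

end Products

/-! ### DR-submodular and smooth functions on the orthant -/

section Orthant

variable {d : ℕ}

theorem convex_nonnegOrthant (d : ℕ) : Convex ℝ (nonnegOrthant d) := by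
  intro x hx y hy a b ha hb _ i
  simpa using add_nonneg (mul_nonneg ha (hx i)) (mul_nonneg hb (hy i))

theorem add_mem_nonnegOrthant {x y : Strategy d} (hx : x ∈ nonnegOrthant d)
    (hy : y ∈ nonnegOrthant d) : x + y ∈ nonnegOrthant d := fun i => by
  simpa using add_nonneg (hx i) (hy i)

theorem smul_mem_nonnegOrthant {x : Strategy d} (hx : x ∈ nonnegOrthant d) {a : ℝ}
    (ha : 0 ≤ a) : a • x ∈ nonnegOrthant d := fun i => by
  simpa using mul_nonneg ha (hx i)

/-- The increment `δ` is added coordinate by coordinate at both base points. Both partial sums stay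
in the orthant with their order preserved, so the one-coordinate inequalities add up. -/
theorem IsDRSubmodularOn.increment_le {f : Strategy d → ℝ}
    (hf : IsDRSubmodularOn (nonnegOrthant d) f) {x y δ : Strategy d} (hx : x ∈ nonnegOrthant d)
    (hxy : ∀ i, x i ≤ y i) (hδ : δ ∈ nonnegOrthant d) :
    f (y + δ) - f y ≤ f (x + δ) - f x := by
  have hy : y ∈ nonnegOrthant d := fun i => (hx i).trans (hxy i)
  have hsingle : ∀ i, EuclideanSpace.single i (δ i) ∈ nonnegOrthant d := fun i j => by
    by_cases h : j = i
    · subst h; simpa using hδ j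
    · simp [h]
  have key : ∀ A : Finset (Fin d),
      (∑ i ∈ A, EuclideanSpace.single i (δ i)) ∈ nonnegOrthant d ∧
      f (y + ∑ i ∈ A, EuclideanSpace.single i (δ i)) - f y ≤
        f (x + ∑ i ∈ A, EuclideanSpace.single i (δ i)) - f x := fun A => by
    induction A using Finset.induction_on with
    | empty => exact ⟨fun i => by simp, by simp⟩
    | insert i A hi ih =>
      rw [Finset.sum_insert hi]
      refine ⟨add_mem_nonnegOrthant (hsingle i) ih.1, ?_⟩
      rw [add_comm (EuclideanSpace.single i (δ i)), ← add_assoc, ← add_assoc]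
      rcases (hδ i).eq_or_lt with h0 | h0
      · have : EuclideanSpace.single i (δ i) = (0 : Strategy d) := by
          rw [← h0]
          ext j
          simp
        simpa [this] using ih.2
      · have h1 := add_mem_nonnegOrthant hx ih.1
        have h2 := add_mem_nonnegOrthant hy ih.1
        have := hf _ h1 _ h2 (fun j => by simpa using hxy j) i (δ i) h0
          (add_mem_nonnegOrthant h1 (hsingle i)) (add_mem_nonnegOrthant h2 (hsingle i))
        linarith [ih.2]
  have hsum : ∑ i, EuclideanSpace.single i (δ i) = δ := by
    ext j
    simp [Finset.sum_apply, Pi.single_apply]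
  simpa [hsum] using (key Finset.univ).2

/-- Discrete concavity along a non-negative ray: every later step gains at most what the first one
does. Subdividing a fixed increment ever more finely turns this into a gradient inequality. -/
theorem IsDRSubmodularOn.sub_le_nat_mul {f : Strategy d → ℝ}
    (hf : IsDRSubmodularOn (nonnegOrthant d) f) {x e : Strategy d} (hx : x ∈ nonnegOrthant d)
    (he : e ∈ nonnegOrthant d) (k : ℕ) :
    f (x + (k : ℝ) • e) - f x ≤ k * (f (x + e) - f x) := by
  induction k with
  | zero => simp
  | succ k ih =>
    have h1 := hf.increment_le hx (y := x + (k : ℝ) • e)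
      (fun i => by simpa using mul_nonneg (Nat.cast_nonneg k) (he i)) he
    have h2 : x + ((k + 1 : ℕ) : ℝ) • e = x + (k : ℝ) • e + e := by
      push_cast
      module
    rw [h2]
    push_cast
    linarith

theorem IsDRSubmodularOn.nat_mul_le_sub {f : Strategy d → ℝ}
    (hf : IsDRSubmodularOn (nonnegOrthant d) f) {x e : Strategy d}
    (he : e ∈ nonnegOrthant d) (k : ℕ) (hx : x - (k : ℝ) • e ∈ nonnegOrthant d) :
    k * (f x - f (x - e)) ≤ f x - f (x - (k : ℝ) • e) := by
  induction k with
  | zero => simp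
  | succ k ih =>
    have h2 : x - ((k + 1 : ℕ) : ℝ) • e = x - (k : ℝ) • e - e := by
      push_cast
      module
    have hk : x - (k : ℝ) • e ∈ nonnegOrthant d := by
      have := add_mem_nonnegOrthant hx he
      rwa [h2, sub_add_cancel] at this
    have h1 := hf.increment_le hx (y := x - e) (fun i => by
      have := mul_nonneg (Nat.cast_nonneg (α := ℝ) k) (he i)
      simp
      linarith) he
    rw [h2, sub_add_cancel, sub_add_cancel] at h1
    have := ih hk
    rw [h2]
    push_cast
    linarith

/-- At boundary points the gradient within `S` is only visible along directions that stay in `S`;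
convexity keeps the whole segment from `x` to `x + δ` inside. -/
theorem tendsto_mul_sub_inner_gradientWithin {S : Set (Strategy d)} (hS : Convex ℝ S)
    {f : Strategy d → ℝ} {x δ : Strategy d} (hf : DifferentiableWithinAt ℝ f S x) (hx : x ∈ S)
    (hxδ : x + δ ∈ S) :
    Tendsto (fun m : ℕ => ((m : ℝ) + 1) * (f (x + ((m : ℝ) + 1)⁻¹ • δ) - f x)) atTop
      (𝓝 (inner ℝ (gradientWithin f S x) δ)) := by
  have hd : Tendsto (fun m : ℕ => ((m : ℝ) + 1)⁻¹ • δ) atTop (𝓝 0) := by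
    simpa using (tendsto_one_div_add_atTop_nhds_zero_nat (𝕜 := ℝ)).smul_const δ
  have h := hf.hasGradientWithinAt.hasFDerivWithinAt.lim (l := (atTop : Filter ℕ))
    (c := fun m : ℕ => (m : ℝ) + 1) (d := fun m : ℕ => ((m : ℝ) + 1)⁻¹ • δ) (v := δ) hd
    (Eventually.of_forall fun m => ?_) ?_
  · simpa using h
  · have := hS hx hxδ (a := 1 - ((m : ℝ) + 1)⁻¹) (b := ((m : ℝ) + 1)⁻¹)
      (sub_nonneg.2 (inv_le_one_of_one_le₀ (by linarith [Nat.cast_nonneg (α := ℝ) m])))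
      (by positivity) (by ring)
    convert this using 1
    module
  · refine tendsto_const_nhds.congr fun m => ?_
    rw [smul_smul, mul_inv_cancel₀ (by positivity), one_smul]

theorem IsDRSubmodularOn.sub_le_inner_gradientWithin {f : Strategy d → ℝ}
    (hf : IsDRSubmodularOn (nonnegOrthant d) f) {x δ : Strategy d} (hx : x ∈ nonnegOrthant d)
    (hδ : δ ∈ nonnegOrthant d) (hd : DifferentiableWithinAt ℝ f (nonnegOrthant d) x) :
    f (x + δ) - f x ≤ inner ℝ (gradientWithin f (nonnegOrthant d) x) δ := by
  refine ge_of_tendsto (tendsto_mul_sub_inner_gradientWithin (convex_nonnegOrthant d) hd hx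
    (add_mem_nonnegOrthant hx hδ)) (Eventually.of_forall fun m => ?_)
  have := hf.sub_le_nat_mul hx
    (smul_mem_nonnegOrthant hδ (a := ((m : ℝ) + 1)⁻¹) (by positivity)) (m + 1)
  push_cast at this
  rwa [smul_smul, mul_inv_cancel₀ (by positivity), one_smul] at this

theorem IsDRSubmodularOn.inner_gradientWithin_le_sub {f : Strategy d → ℝ}
    (hf : IsDRSubmodularOn (nonnegOrthant d) f) {x δ : Strategy d} (hx : x ∈ nonnegOrthant d)
    (hδ : δ ∈ nonnegOrthant d) (hxδ : x - δ ∈ nonnegOrthant d)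
    (hd : DifferentiableWithinAt ℝ f (nonnegOrthant d) x) :
    inner ℝ (gradientWithin f (nonnegOrthant d) x) δ ≤ f x - f (x - δ) := by
  have h := ge_of_tendsto (tendsto_mul_sub_inner_gradientWithin (convex_nonnegOrthant d) hd hx
    (δ := -δ) (by rwa [← sub_eq_add_neg])) (b := f (x - δ) - f x)
    (Eventually.of_forall fun m => ?_)
  · rw [inner_neg_right] at h
    linarith
  have h2 : (((m + 1 : ℕ) : ℝ)) • ((m : ℝ) + 1)⁻¹ • δ = δ := by
    push_cast
    rw [smul_smul, mul_inv_cancel₀ (by positivity), one_smul]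
  have := hf.nat_mul_le_sub (x := x)
    (smul_mem_nonnegOrthant hδ (a := ((m : ℝ) + 1)⁻¹) (by positivity)) (m + 1) (by rwa [h2])
  rw [h2] at this
  push_cast at this
  rw [smul_neg, ← sub_eq_add_neg]
  linarith

/-- At the boundary, the Lipschitz constant controls directional derivatives only in feasible
directions. Monotonicity makes the gradient itself a non-negative vector, so it may be used as the
test direction. -/
theorem norm_gradientWithin_le_of_lipschitzOnWith {f : Strategy d → ℝ} {L : ℝ≥0}
    (hmono : IsMonotoneOn (nonnegOrthant d) f) (hlip : LipschitzOnWith L f (nonnegOrthant d))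
    {x : Strategy d} (hx : x ∈ nonnegOrthant d)
    (hd : DifferentiableWithinAt ℝ f (nonnegOrthant d) x) :
    ‖gradientWithin f (nonnegOrthant d) x‖ ≤ L := by
  set G := gradientWithin f (nonnegOrthant d) x with hG
  have hlim : ∀ δ ∈ nonnegOrthant d, 0 ≤ inner ℝ G δ ∧ inner ℝ G δ ≤ L * ‖δ‖ := by
    intro δ hδ
    have ht := tendsto_mul_sub_inner_gradientWithin (convex_nonnegOrthant d) hd hx
      (add_mem_nonnegOrthant hx hδ)
    have hmem : ∀ m : ℕ, ((m : ℝ) + 1)⁻¹ • δ ∈ nonnegOrthant d := fun m =>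
      smul_mem_nonnegOrthant hδ (by positivity)
    constructor
    · refine ge_of_tendsto ht (Eventually.of_forall fun m => ?_)
      refine mul_nonneg (by positivity) (sub_nonneg.2 ?_)
      exact hmono _ hx _ (add_mem_nonnegOrthant hx (hmem m)) fun i => by
        simpa using hmem m i
    · refine le_of_tendsto ht (Eventually.of_forall fun m => ?_)
      have h1 := hlip.dist_le_mul _ (add_mem_nonnegOrthant hx (hmem m)) _ hx
      rw [Real.dist_eq, dist_eq_norm, add_sub_cancel_left, norm_smul, norm_inv,
        Real.norm_of_nonneg (by positivity : (0 : ℝ) ≤ (m : ℝ) + 1)] at h1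
      have h2 := (le_abs_self _).trans h1
      have hm : (0 : ℝ) < (m : ℝ) + 1 := by positivity
      calc ((m : ℝ) + 1) * (f (x + ((m : ℝ) + 1)⁻¹ • δ) - f x)
          ≤ ((m : ℝ) + 1) * (L * (((m : ℝ) + 1)⁻¹ * ‖δ‖)) :=
            mul_le_mul_of_nonneg_left h2 hm.le
        _ = L * ‖δ‖ := by field_simp
  have hGmem : G ∈ nonnegOrthant d := fun i => by
    have := (hlim (EuclideanSpace.single i 1) fun j => by
      by_cases h : j = i
      · subst h; simp
      · simp [h]).1
    simpa [EuclideanSpace.inner_single_right] using this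
  have h := (hlim G hGmem).2
  rw [real_inner_self_eq_norm_sq, sq] at h
  rcases (norm_nonneg G).eq_or_lt with h0 | h0
  · rw [← h0]; exact L.2
  · exact le_of_mul_le_mul_right h h0

/-- Quadratic lower bound for a function with Lipschitz gradient on a convex set. -/
theorem add_inner_sub_le_of_lipschitz_gradient {S : Set (Strategy d)} (hS : Convex ℝ S)
    {f : Strategy d → ℝ} {G : Strategy d → Strategy d} {β : ℝ}
    (hf : ∀ x ∈ S, HasGradientWithinAt f (G x) S x)
    (hG : ∀ x ∈ S, ∀ y ∈ S, ‖G x - G y‖ ≤ β * ‖x - y‖)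
    {x y : Strategy d} (hx : x ∈ S) (hy : y ∈ S) :
    f x + inner ℝ (G x) (y - x) - β / 2 * ‖y - x‖ ^ 2 ≤ f y := by
  set l : ℝ → Strategy d := fun t => x + t • (y - x) with hl
  have hlS : ∀ t ∈ Set.Icc (0 : ℝ) 1, l t ∈ S := fun t ht => by
    have := hS hx hy (sub_nonneg.2 ht.2) ht.1 (by ring)
    convert this using 1
    simp only [hl]
    module
  have hld : ∀ t, HasDerivAt l (y - x) t := fun t => by
    simpa [hl] using ((hasDerivAt_id t).smul_const (y - x)).const_add x
  have hderiv : ∀ t ∈ Set.Icc (0 : ℝ) 1,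
      HasDerivWithinAt (fun t => f (l t)) (inner ℝ (G (l t)) (y - x)) (Set.Icc 0 1) t := by
    intro t ht
    have := (hf _ (hlS t ht)).hasFDerivWithinAt.comp_hasDerivWithinAt t
      (hld t).hasDerivWithinAt hlS
    rw [InnerProductSpace.toDual_apply_apply] at this
    exact this
  have hderiv2 : ∀ t ∈ Set.Icc (0 : ℝ) 1,
      HasDerivWithinAt (fun t => f (l t) - t * inner ℝ (G x) (y - x) +
          β / 2 * ‖y - x‖ ^ 2 * t ^ 2)
        (inner ℝ (G (l t)) (y - x) - inner ℝ (G x) (y - x) + β * ‖y - x‖ ^ 2 * t)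
        (Set.Icc 0 1) t := by
    intro t ht
    have h1 := (((hderiv t ht).sub
      ((hasDerivWithinAt_id t _).mul_const (inner ℝ (G x) (y - x)))).add
      (((hasDerivWithinAt_id t (Set.Icc 0 1)).pow 2).const_mul (β / 2 * ‖y - x‖ ^ 2)))
    refine h1.congr_deriv ?_
    dsimp
    ring
  -- The quadratic term compensates the change of the gradient along the segment, which is at most
  -- `β * t * ‖y - x‖` at time `t`.
  have hmono : MonotoneOn (fun t => f (l t) - t * inner ℝ (G x) (y - x) +
      β / 2 * ‖y - x‖ ^ 2 * t ^ 2) (Set.Icc (0 : ℝ) 1) := by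
    refine monotoneOn_of_deriv_nonneg (convex_Icc 0 1)
      (fun t ht => (hderiv2 t ht).continuousWithinAt) ?_ ?_
    · intro t ht
      exact ((hderiv2 t (interior_subset ht)).mono interior_subset).differentiableWithinAt
    · intro t ht
      rw [interior_Icc] at ht
      have ht' := Set.Ioo_subset_Icc_self ht
      rw [((hderiv2 t ht').hasDerivAt (Icc_mem_nhds ht.1 ht.2)).deriv]
      have h1 : ‖G (l t) - G x‖ ≤ β * (t * ‖y - x‖) := by
        have := hG _ (hlS t ht') _ hx
        rwa [hl, add_sub_cancel_left, norm_smul, Real.norm_of_nonneg ht'.1] at this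
      have h2 := (abs_le.1 (abs_real_inner_le_norm (G (l t) - G x) (y - x))).1
      rw [inner_sub_left] at h2
      nlinarith [mul_le_mul_of_nonneg_right h1 (norm_nonneg (y - x))]
  have h := hmono (Set.left_mem_Icc.2 zero_le_one) (Set.right_mem_Icc.2 zero_le_one) zero_le_one
  simp only [hl] at h
  simp at h
  linarith

end Orthant

section ListSums

theorem inner_list_sum {E ι : Type*} [NormedAddCommGroup E] [InnerProductSpace ℝ E]
    (l : List ι) (f : ι → E) (v : E) :
    inner ℝ (l.map f).sum v = (l.map fun i => inner ℝ (f i) v).sum := by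
  induction l with
  | nil => simp
  | cons i l ih => simp [inner_add_left, ih]

end ListSums

/-! ### Smoothness and first-order inequality of coverage -/

namespace CIMBS

variable {V : Type*} {d : ℕ}

/-- The standing assumptions on the activation functions, with Lipschitz constant `L` and smoothness
constant `β`. -/
structure IsRegular (I : CIMBS V d) (L β : ℝ≥0) : Prop where
  range : ∀ v, ∀ x ∈ nonnegOrthant d, I.h v x ∈ Set.Icc (0 : ℝ) 1
  mono : ∀ v, IsMonotoneOn (nonnegOrthant d) (I.h v)
  dr : ∀ v, IsDRSubmodularOn (nonnegOrthant d) (I.h v)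
  lip : ∀ v, LipschitzOnWith L (I.h v) (nonnegOrthant d)
  smooth : ∀ v, IsSmoothOn β (nonnegOrthant d) (I.h v)

section Coverage

variable {I : CIMBS V d} {L β : ℝ≥0} {x y : Strategy d}

theorem IsRegular.one_sub_mem (hI : I.IsRegular L β) (hx : x ∈ nonnegOrthant d) (v : V) :
    1 - I.h v x ∈ Set.Icc (0 : ℝ) 1 :=
  ⟨sub_nonneg.2 (hI.range v x hx).2, by linarith [(hI.range v x hx).1]⟩

theorem IsRegular.prod_mem (hI : I.IsRegular L β) (hx : x ∈ nonnegOrthant d) (R : Finset V) :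
    ∏ v ∈ R, (1 - I.h v x) ∈ Set.Icc (0 : ℝ) 1 :=
  ⟨Finset.prod_nonneg fun v _ => (hI.one_sub_mem hx v).1,
    Finset.prod_le_one (fun v _ => (hI.one_sub_mem hx v).1) fun v _ => (hI.one_sub_mem hx v).2⟩

theorem IsRegular.coverage_nonneg (hI : I.IsRegular L β) (hx : x ∈ nonnegOrthant d)
    (R : Finset V) : 0 ≤ I.coverage x R := sub_nonneg.2 (hI.prod_mem hx R).2

theorem IsRegular.coverage_le_one (hI : I.IsRegular L β) (hx : x ∈ nonnegOrthant d)
    (R : Finset V) : I.coverage x R ≤ 1 := sub_le_self _ (hI.prod_mem hx R).1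

theorem IsRegular.norm_gradH_le (hI : I.IsRegular L β) (hx : x ∈ nonnegOrthant d) (v : V) :
    ‖I.gradH v x‖ ≤ L :=
  norm_gradientWithin_le_of_lipschitzOnWith (hI.mono v) (hI.lip v) hx ((hI.smooth v).1 x hx)

theorem IsRegular.abs_prod_sub_prod_le (hI : I.IsRegular L β) (hx : x ∈ nonnegOrthant d)
    (hy : y ∈ nonnegOrthant d) (R : Finset V) :
    |∏ v ∈ R, (1 - I.h v x) - ∏ v ∈ R, (1 - I.h v y)| ≤ R.card * (L * ‖x - y‖) := by
  refine (abs_prod_sub_prod_le_sum R (hI.one_sub_mem hx) (hI.one_sub_mem hy)).trans ?_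
  rw [← nsmul_eq_mul]
  refine Finset.sum_le_card_nsmul _ _ _ fun v _ => ?_
  rw [sub_sub_sub_cancel_left, abs_sub_comm]
  have := (hI.lip v).dist_le_mul x hx y hy
  rwa [Real.dist_eq, dist_eq_norm] at this

theorem IsRegular.abs_coverage_sub_le (hI : I.IsRegular L β) (hx : x ∈ nonnegOrthant d)
    (hy : y ∈ nonnegOrthant d) (R : Finset V) :
    |I.coverage x R - I.coverage y R| ≤ R.card * (L * ‖x - y‖) := by
  rw [coverage, coverage, sub_sub_sub_cancel_left, abs_sub_comm]
  exact hI.abs_prod_sub_prod_le hx hy R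

variable [DecidableEq V]

/-- The gradient of the coverage of `R`. -/
noncomputable def gradCoverage (I : CIMBS V d) (x : Strategy d) (R : Finset V) : Strategy d :=
  ∑ v' ∈ R, (∏ v ∈ R.erase v', (1 - I.h v x)) • I.gradH v' x

theorem IsRegular.hasGradientWithinAt_coverage (hI : I.IsRegular L β) (hx : x ∈ nonnegOrthant d)
    (R : Finset V) :
    HasGradientWithinAt (fun x => I.coverage x R) (I.gradCoverage x R) (nonnegOrthant d) x := by
  have h := (HasFDerivWithinAt.finsetProd (u := R) fun v _ =>
    (((hI.smooth v).1 x hx).hasGradientWithinAt.hasFDerivWithinAt).const_sub 1).const_sub 1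
  rw [hasGradientWithinAt_iff_hasFDerivWithinAt]
  refine h.congr_fderiv ?_
  simp [gradCoverage, gradH, map_sum, Finset.sum_neg_distrib]

/-- In each of the `|R|` summands, a change of the product costs at most `|R| * L` times the
gradient norm `L`, and a change of the gradient costs `β`. Averaging over the sample and multiplying
by `n` turns these constants into `betaHat`. -/
theorem IsRegular.norm_gradCoverage_sub_le (hI : I.IsRegular L β) (hx : x ∈ nonnegOrthant d)
    (hy : y ∈ nonnegOrthant d) (R : Finset V) :
    ‖I.gradCoverage x R - I.gradCoverage y R‖ ≤
      ((R.card : ℝ) * β + (R.card : ℝ) ^ 2 * (L : ℝ) ^ 2) * ‖x - y‖ := by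
  rw [gradCoverage, gradCoverage, ← Finset.sum_sub_distrib]
  refine (norm_sum_le_of_le R
    (n := fun _ => (β + (R.card : ℝ) * (L : ℝ) ^ 2) * ‖x - y‖) fun v hv => ?_).trans ?_
  · set a := ∏ w ∈ R.erase v, (1 - I.h w x)
    set b := ∏ w ∈ R.erase v, (1 - I.h w y)
    have h1 : a • I.gradH v x - b • I.gradH v y =
        (a - b) • I.gradH v x + b • (I.gradH v x - I.gradH v y) := by module
    have hab : |a - b| ≤ R.card * (L * ‖x - y‖) := by
      refine (hI.abs_prod_sub_prod_le hx hy _).trans ?_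
      gcongr
      exact Finset.erase_subset _ _
    have hb := hI.prod_mem hy (R.erase v)
    have hg : ‖I.gradH v x - I.gradH v y‖ ≤ β * ‖x - y‖ := by
      have := (hI.smooth v).2.dist_le_mul x hx y hy
      rwa [dist_eq_norm, dist_eq_norm] at this
    rw [h1]
    refine (norm_add_le _ _).trans ?_
    rw [norm_smul, norm_smul, Real.norm_eq_abs, Real.norm_of_nonneg hb.1]
    have h2 := mul_le_mul hab (hI.norm_gradH_le hx v) (norm_nonneg _) (by positivity)
    have h3 := mul_le_mul hb.2 hg (norm_nonneg _) zero_le_one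
    linarith
  · rw [Finset.sum_const, nsmul_eq_mul]
    refine le_of_eq ?_
    ring

theorem IsRegular.coverage_quadratic_lower (hI : I.IsRegular L β) (hx : x ∈ nonnegOrthant d)
    (hy : y ∈ nonnegOrthant d) (R : Finset V) :
    I.coverage x R + inner ℝ (I.gradCoverage x R) (y - x) -
      ((R.card : ℝ) * β + (R.card : ℝ) ^ 2 * (L : ℝ) ^ 2) / 2 * ‖y - x‖ ^ 2 ≤ I.coverage y R :=
  add_inner_sub_le_of_lipschitz_gradient (convex_nonnegOrthant d)
    (f := fun x => I.coverage x R) (G := fun x => I.gradCoverage x R)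
    (fun _ hz => hI.hasGradientWithinAt_coverage hz R)
    (fun _ hz _ hw => hI.norm_gradCoverage_sub_le hz hw R) hx hy

theorem inner_gradCoverage (x z : Strategy d) (R : Finset V) :
    inner ℝ (I.gradCoverage x R) z =
      ∑ v' ∈ R, (∏ v ∈ R.erase v', (1 - I.h v x)) * inner ℝ (I.gradH v' x) z := by
  simp only [gradCoverage, sum_inner, real_inner_smul_left]

/-- The first-order inequality that yields the factor `1 / 2` for monotone DR-submodular
functions. -/
theorem IsRegular.coverage_sub_two_mul_le (hI : I.IsRegular L β) (hx : x ∈ nonnegOrthant d)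
    (hy : y ∈ nonnegOrthant d) (R : Finset V) :
    I.coverage y R - 2 * I.coverage x R ≤ inner ℝ (I.gradCoverage x R) (y - x) := by
  -- With these positive and negative parts of `y - x`, `x + δ` is the join and `x - γ` the meet of
  -- `x` and `y`. The step up gains at most `⟪∇, δ⟫` and reaches at least `coverage y`; the step
  -- down loses at least `⟪∇, γ⟫`, but never more than `coverage x`.
  set δ : Strategy d := WithLp.toLp 2 fun i => max (y i - x i) 0 with hδ
  set γ : Strategy d := WithLp.toLp 2 fun i => max (x i - y i) 0 with hγ
  have hδ0 : δ ∈ nonnegOrthant d := fun i => le_max_right _ _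
  have hγ0 : γ ∈ nonnegOrthant d := fun i => le_max_right _ _
  have hxδ := add_mem_nonnegOrthant hx hδ0
  have hxγ : x - γ ∈ nonnegOrthant d := fun i => by
    have : max (x i - y i) 0 ≤ x i := max_le (by linarith [hy i]) (hx i)
    simpa [hγ] using this
  have hyx : y - x = δ - γ := by
    ext i
    simp only [hδ, hγ, PiLp.sub_apply]
    rcases le_total (x i) (y i) with h | h
    · rw [max_eq_left (by linarith), max_eq_right (by linarith)]; ring
    · rw [max_eq_right (by linarith), max_eq_left (by linarith)]; ring
  have hle : ∀ i, y i ≤ (x + δ) i := fun i => by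
    have : y i - x i ≤ max (y i - x i) 0 := le_max_left _ _
    simp only [hδ, PiLp.add_apply]
    linarith
  have hup : I.coverage (x + δ) R - I.coverage x R ≤ inner ℝ (I.gradCoverage x R) δ := by
    rw [inner_gradCoverage]
    have h1 := prod_sub_prod_le_sum_erase (a := fun v => 1 - I.h v x)
      (b := fun v => 1 - I.h v (x + δ)) R (fun v _ => (hI.one_sub_mem hxδ v).1) fun v _ => by
        have := hI.mono v x hx _ hxδ fun i => by simpa using hδ0 i
        linarith
    have h2 : ∑ v ∈ R, (∏ w ∈ R.erase v, (1 - I.h w x)) *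
        ((1 - I.h v x) - (1 - I.h v (x + δ))) ≤
        ∑ v' ∈ R, (∏ v ∈ R.erase v', (1 - I.h v x)) * inner ℝ (I.gradH v' x) δ := by
      refine Finset.sum_le_sum fun v _ => mul_le_mul_of_nonneg_left ?_ (hI.prod_mem hx _).1
      have := (hI.dr v).sub_le_inner_gradientWithin hx hδ0 ((hI.smooth v).1 x hx)
      rw [gradH]
      linarith
    simp only [coverage]
    linarith
  have hdown : inner ℝ (I.gradCoverage x R) γ ≤ I.coverage x R - I.coverage (x - γ) R := by
    rw [inner_gradCoverage]
    have h1 := sum_erase_le_prod_sub_prod (a := fun v => 1 - I.h v x)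
      (c := fun v => 1 - I.h v (x - γ)) R (fun v _ => (hI.one_sub_mem hx v).1) fun v _ => by
        have := hI.mono v _ hxγ x hx fun i => by simpa using hγ0 i
        linarith
    have h2 : ∑ v' ∈ R, (∏ v ∈ R.erase v', (1 - I.h v x)) * inner ℝ (I.gradH v' x) γ ≤
        ∑ v ∈ R, (∏ w ∈ R.erase v, (1 - I.h w x)) *
          ((1 - I.h v (x - γ)) - (1 - I.h v x)) := by
      refine Finset.sum_le_sum fun v _ => mul_le_mul_of_nonneg_left ?_ (hI.prod_mem hx _).1
      have := (hI.dr v).inner_gradientWithin_le_sub hx hγ0 hxγ ((hI.smooth v).1 x hx)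
      rw [gradH]
      linarith
    simp only [coverage]
    linarith
  have hmono : I.coverage y R ≤ I.coverage (x + δ) R := by
    refine sub_le_sub_left (Finset.prod_le_prod (fun v _ => (hI.one_sub_mem hxδ v).1)
      fun v _ => sub_le_sub_left (hI.mono v y hy _ hxδ hle) _) _
  rw [hyx, inner_sub_right]
  linarith [hI.coverage_nonneg hxγ R]

end Coverage

/-! ### Transfer from coverage to the estimator and to `g` -/

section Estimator

variable [Fintype V] {I : CIMBS V d} {p : ProxGradInput d} {L β : ℝ≥0}
  {x y : Strategy d}

theorem gHat_eq (Rs : List (Finset V)) (x : Strategy d) :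
    I.gHat Rs x = (Fintype.card V : ℝ) / Rs.length * (Rs.map (I.coverage x)).sum := rfl

theorem IsRegular.gHat_nonneg (hI : I.IsRegular L β) (hx : x ∈ nonnegOrthant d)
    (Rs : List (Finset V)) : 0 ≤ I.gHat Rs x := by
  refine mul_nonneg (by positivity) (List.sum_nonneg fun a ha => ?_)
  obtain ⟨R, -, rfl⟩ := List.mem_map.1 ha
  exact hI.coverage_nonneg hx R

theorem IsRegular.abs_gHat_sub_le (hI : I.IsRegular L β) (hx : x ∈ nonnegOrthant d)
    (hy : y ∈ nonnegOrthant d) (Rs : List (Finset V)) :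
    |I.gHat Rs x - I.gHat Rs y| ≤ (Fintype.card V : ℝ) ^ 2 * L * ‖x - y‖ := by
  have h : |(Rs.map (I.coverage x)).sum - (Rs.map (I.coverage y)).sum| ≤
      Rs.length * (Fintype.card V * (L * ‖x - y‖)) := by
    induction Rs with
    | nil => simp
    | cons R Rs ih =>
      simp only [List.map_cons, List.sum_cons, List.length_cons]
      rw [add_sub_add_comm]
      refine (abs_add_le _ _).trans ?_
      have h1 := hI.abs_coverage_sub_le hx hy R
      have h2 : (R.card : ℝ) * (L * ‖x - y‖) ≤ Fintype.card V * (L * ‖x - y‖) := by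
        gcongr
        exact R.card_le_univ
      push_cast
      linarith
  have h3 : I.gHat Rs x - I.gHat Rs y = (Fintype.card V : ℝ) / Rs.length *
      ((Rs.map (I.coverage x)).sum - (Rs.map (I.coverage y)).sum) := by
    rw [mul_sub]
    rfl
  rw [h3, abs_mul, abs_of_nonneg (by positivity)]
  rcases Nat.eq_zero_or_pos Rs.length with h0 | h0
  · rw [h0]
    simp only [Nat.cast_zero, div_zero, zero_mul]
    positivity
  · refine (mul_le_mul_of_nonneg_left h (by positivity)).trans (le_of_eq ?_)
    have : (Rs.length : ℝ) ≠ 0 := by positivity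
    field_simp

variable [DecidableEq V]

theorem inner_gradGHat (Rs : List (Finset V)) (x v : Strategy d) :
    inner ℝ (I.gradGHat Rs x) v = (Fintype.card V : ℝ) / Rs.length *
      (Rs.map fun R => inner ℝ (I.gradCoverage x R) v).sum := by
  rw [gradGHat, real_inner_smul_left, inner_list_sum]
  rfl

theorem IsRegular.gHat_sub_two_mul_le (hI : I.IsRegular L β) (hx : x ∈ nonnegOrthant d)
    (hy : y ∈ nonnegOrthant d) (Rs : List (Finset V)) :
    I.gHat Rs y - 2 * I.gHat Rs x ≤ inner ℝ (I.gradGHat Rs x) (y - x) := by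
  have h : (Rs.map (I.coverage y)).sum - 2 * (Rs.map (I.coverage x)).sum ≤
      (Rs.map fun R => inner ℝ (I.gradCoverage x R) (y - x)).sum := by
    induction Rs with
    | nil => simp
    | cons R Rs ih =>
      simp only [List.map_cons, List.sum_cons]
      linarith [hI.coverage_sub_two_mul_le hx hy R]
  have hn : 0 ≤ (Fintype.card V : ℝ) / Rs.length := by positivity
  have := mul_le_mul_of_nonneg_left h hn
  rw [inner_gradGHat]
  refine le_trans (le_of_eq ?_) this
  rw [mul_sub, mul_left_comm]
  rfl

theorem IsRegular.gHat_quadratic_lower (hI : I.IsRegular p.Lh p.βh) (hx : x ∈ nonnegOrthant d)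
    (hy : y ∈ nonnegOrthant d) (Rs : List (Finset V)) :
    I.gHat Rs x + inner ℝ (I.gradGHat Rs x) (y - x) -
      betaHat p Rs / 2 * ‖y - x‖ ^ 2 ≤ I.gHat Rs y := by
  have h : (Rs.map (I.coverage x)).sum +
      (Rs.map fun R => inner ℝ (I.gradCoverage x R) (y - x)).sum -
      ((Rs.map fun R => (R.card : ℝ) ^ 1).sum * p.βh +
        (Rs.map fun R => (R.card : ℝ) ^ 2).sum * (p.Lh : ℝ) ^ 2) / 2 * ‖y - x‖ ^ 2 ≤
      (Rs.map (I.coverage y)).sum := by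
    induction Rs with
    | nil => simp
    | cons R Rs ih =>
      simp only [List.map_cons, List.sum_cons, pow_one] at ih ⊢
      linarith [hI.coverage_quadratic_lower hx hy R]
  have hn : 0 ≤ (Fintype.card V : ℝ) / Rs.length := by positivity
  have := mul_le_mul_of_nonneg_left h hn
  rw [inner_gradGHat]
  refine le_trans (le_of_eq ?_) this
  simp only [betaHat, nu, gHat_eq]
  ring

theorem IsRegular.abs_g_sub_le [Nonempty V] (hI : I.IsRegular L β) (hx : x ∈ nonnegOrthant d)
    (hy : y ∈ nonnegOrthant d) :
    |I.g x - I.g y| ≤ (Fintype.card V : ℝ) ^ 2 * L * ‖x - y‖ := by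
  have h : |I.model.rrMean (I.coverage x) - I.model.rrMean (I.coverage y)| ≤
      Fintype.card V * (L * ‖x - y‖) := by
    rw [TriggeringModel.rrMean, TriggeringModel.rrMean, ← Finset.sum_sub_distrib]
    refine (Finset.abs_sum_le_sum_abs _ _).trans ?_
    rw [← one_mul (_ * (_ * _)), ← I.model.sum_rrLaw_toReal, Finset.sum_mul]
    refine Finset.sum_le_sum fun R _ => ?_
    rw [← mul_sub, abs_mul, abs_of_nonneg ENNReal.toReal_nonneg]
    refine mul_le_mul_of_nonneg_left ((hI.abs_coverage_sub_le hx hy R).trans ?_)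
      ENNReal.toReal_nonneg
    gcongr
    exact R.card_le_univ
  rw [g_eq_card_mul_rrMean, g_eq_card_mul_rrMean, ← mul_sub, abs_mul,
    abs_of_nonneg (Nat.cast_nonneg _)]
  refine (mul_le_mul_of_nonneg_left h (Nat.cast_nonneg _)).trans (le_of_eq ?_)
  ring

theorem IsRegular.g_nonneg [Nonempty V] (hI : I.IsRegular L β) (hx : x ∈ nonnegOrthant d) :
    0 ≤ I.g x := by
  rw [g_eq_card_mul_rrMean]
  exact mul_nonneg (Nat.cast_nonneg _) (I.model.rrMean_nonneg (hI.coverage_nonneg hx))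

end Estimator

end CIMBS

/-! ### Convergence of the proximal gradient iteration -/

/-- Rate of the proximal gradient iteration, in terms of the gaps `G t` to half the optimum and the
distances `D t` to an optimal point. -/
theorem gap_le_of_telescoping {G D s : ℕ → ℝ} {b Δ : ℝ} (T : ℕ) (hb : 0 < b)
    (hG : ∀ t < T, G t + G (t + 1) ≤ b * (D t ^ 2 - D (t + 1) ^ 2))
    (hs : ∀ t < T, b * s t ^ 2 ≤ G t - G (t + 1))
    (hD : ∀ t < T, D t - D (t + 1) ≤ s t) (hD0 : ∀ t ≤ T, 0 ≤ D t) (hDΔ : ∀ t ≤ T, D t ≤ Δ) :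
    T * G T ≤ 5 / 12 * (b * Δ ^ 2) := by
  rcases Nat.eq_zero_or_pos T with rfl | hT
  · simp only [Nat.cast_zero, zero_mul]
    positivity
  rcases le_or_gt (G T) 0 with hA | hA
  · calc (T : ℝ) * G T ≤ 0 := mul_nonpos_of_nonneg_of_nonpos (Nat.cast_nonneg _) hA
      _ ≤ _ := by positivity
  set A := G T with hAdef
  have hΔ0 : 0 ≤ Δ := (hD0 T le_rfl).trans (hDΔ T le_rfl)
  -- As long as the gap is at least `A > 0`, the distance to `y` decreases by a definite amount,
  -- which forces a step of length at least `A / (b * Δ)`.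
  have hstep : ∀ t < T, A ≤ G t → A ≤ G (t + 1) → A ≤ b * s t * Δ := by
    intro t ht h1 h2
    have h3 := hG t ht
    have hpos : 0 < (D t - D (t + 1)) * (D t + D (t + 1)) := by
      have : 0 < b * ((D t - D (t + 1)) * (D t + D (t + 1))) := by nlinarith
      exact (mul_pos_iff_of_pos_left hb).1 this
    have hsum : 0 ≤ D t + D (t + 1) := add_nonneg (hD0 t ht.le) (hD0 (t + 1) ht)
    have hdiff : 0 < D t - D (t + 1) := pos_of_mul_pos_left hpos hsum
    have hs0 : 0 ≤ s t := hdiff.le.trans (hD t ht)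
    have h4 : (D t - D (t + 1)) * (D t + D (t + 1)) ≤ s t * (2 * Δ) :=
      mul_le_mul (hD t ht) (by linarith [hDΔ t ht.le, hDΔ (t + 1) ht]) hsum hs0
    nlinarith [mul_le_mul_of_nonneg_left h4 hb.le]
  have hΔ : 0 < Δ := by
    rcases hΔ0.eq_or_lt with h | h
    · exfalso
      have hanti : ∀ j ≤ T, A ≤ G (T - j) := by
        intro j hj
        induction j with
        | zero => simp [hAdef]
        | succ j ih =>
          have := hs (T - (j + 1)) (by omega)
          rw [show T - (j + 1) + 1 = T - j by omega] at this
          nlinarith [ih (by omega), mul_nonneg hb.le (sq_nonneg (s (T - (j + 1))))]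
      have := hstep (T - 1) (by omega) (hanti 1 hT)
        (by rw [Nat.sub_add_cancel hT])
      rw [← h, mul_zero] at this
      linarith
    · exact h
  -- This is the least decrease of the gap per step, by the bound on the step length. Hence the gaps
  -- grow at least linearly backwards from time `T`, which improves on the telescoped bound `2 * T *
  -- A ≤ b * Δ ^ 2`.
  set κ := A ^ 2 / (b * Δ ^ 2) with hκ
  have hbΔ : 0 < b * Δ ^ 2 := by positivity
  have hκ0 : 0 ≤ κ := by positivity
  have hκs : ∀ t < T, A ≤ G t → A ≤ G (t + 1) → κ ≤ b * s t ^ 2 := by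
    intro t ht h1 h2
    have h := hstep t ht h1 h2
    rw [hκ, div_le_iff₀ hbΔ]
    have h5 : A ^ 2 ≤ (b * s t * Δ) ^ 2 := pow_le_pow_left₀ hA.le h 2
    linarith
  have key : ∀ j ≤ T, A + j * κ ≤ G (T - j) ∧
      2 * j * A + (j : ℝ) ^ 2 * κ ≤ b * (D (T - j) ^ 2 - D T ^ 2) := by
    intro j hj
    induction j with
    | zero => simp [hAdef]
    | succ j ih =>
      obtain ⟨ih1, ih2⟩ := ih (by omega)
      have ht : T - (j + 1) < T := by omega
      have hsucc : T - (j + 1) + 1 = T - j := by omega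
      have h1 := hs _ ht
      have h2 := hG _ ht
      rw [hsucc] at h1 h2
      have h3 : A ≤ G (T - j) := by nlinarith [mul_nonneg (Nat.cast_nonneg (α := ℝ) j) hκ0]
      have h4 : A ≤ G (T - (j + 1)) := by
        nlinarith [mul_nonneg hb.le (sq_nonneg (s (T - (j + 1))))]
      have h5 := hκs _ ht h4 (by rwa [hsucc])
      push_cast
      constructor <;> nlinarith
  have h1 := (key T le_rfl).2
  rw [Nat.sub_self] at h1
  have h2 : b * (D 0 ^ 2 - D T ^ 2) ≤ b * Δ ^ 2 := by
    refine mul_le_mul_of_nonneg_left ?_ hb.le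
    have := pow_le_pow_left₀ (hD0 0 (Nat.zero_le _)) (hDΔ 0 (Nat.zero_le _)) 2
    nlinarith [sq_nonneg (D T)]
  set a := T * A / (b * Δ ^ 2) with ha
  have ha0 : 0 ≤ a := by positivity
  have h3 : T * A = a * (b * Δ ^ 2) := by rw [ha]; field_simp
  have h4 : (T : ℝ) ^ 2 * κ = a ^ 2 * (b * Δ ^ 2) := by rw [hκ, ha]; field_simp
  have h5 : 2 * a + a ^ 2 ≤ 1 := by
    by_contra hcon
    push Not at hcon
    nlinarith [mul_lt_mul_of_pos_right hcon hbΔ]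
  -- The positive root of `2a + a² = 1` is `√2 - 1 < 5/12`. Plain telescoping would give only `1/2`,
  -- which is too weak for the error budget of the final phase.
  have h6 : a ≤ 5 / 12 := by nlinarith
  rw [h3]
  exact mul_le_mul_of_nonneg_right h6 hbΔ.le

/-- A minimiser of a convex function plus the half squared distance to `u` beats every other point
by the half squared distance to it. -/
theorem add_half_sq_dist_le_of_isMinOn {d : ℕ} {K : Set (Strategy d)} (hK : Convex ℝ K)
    {f : Strategy d → ℝ} (hf : ConvexOn ℝ K f) {u p y : Strategy d} (hp : p ∈ K)
    (hmin : IsMinOn (fun z => f z + 1 / 2 * ‖u - z‖ ^ 2) K p) (hy : y ∈ K) :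
    f p + 1 / 2 * ‖u - p‖ ^ 2 + 1 / 2 * ‖y - p‖ ^ 2 ≤ f y + 1 / 2 * ‖u - y‖ ^ 2 := by
  have key : ∀ t : ℝ, 0 < t → t ≤ 1 → f p + 1 / 2 * ‖u - p‖ ^ 2 + (1 - t) / 2 * ‖y - p‖ ^ 2 ≤
      f y + 1 / 2 * ‖u - y‖ ^ 2 := by
    intro t ht0 ht1
    have hz := hK hp hy (sub_nonneg.2 ht1) ht0.le (by ring)
    have h1 : f p + 1 / 2 * ‖u - p‖ ^ 2 ≤
        f ((1 - t) • p + t • y) + 1 / 2 * ‖u - ((1 - t) • p + t • y)‖ ^ 2 := hmin hz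
    have h2 := hf.2 hp hy (sub_nonneg.2 ht1) ht0.le (by ring)
    have h3 : ‖u - ((1 - t) • p + t • y)‖ ^ 2 =
        (1 - t) * ‖u - p‖ ^ 2 + t * ‖u - y‖ ^ 2 - t * (1 - t) * ‖y - p‖ ^ 2 := by
      have e1 : u - ((1 - t) • p + t • y) = (1 - t) • (u - p) + t • (u - y) := by module
      have e2 : y - p = (u - p) - (u - y) := by abel
      rw [e1, e2, norm_add_sq_real, norm_sub_sq_real (u - p), norm_smul, norm_smul,
        real_inner_smul_left, real_inner_smul_right, mul_pow, mul_pow, Real.norm_eq_abs,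
        Real.norm_eq_abs, sq_abs, sq_abs]
      ring
    rw [h3] at h1
    simp only [smul_eq_mul] at h2
    have h4 : t * (f p + 1 / 2 * ‖u - p‖ ^ 2 + (1 - t) / 2 * ‖y - p‖ ^ 2) ≤
        t * (f y + 1 / 2 * ‖u - y‖ ^ 2) := by linarith
    exact le_of_mul_le_mul_left h4 ht0
  by_contra hcon
  push Not at hcon
  set e := f p + 1 / 2 * ‖u - p‖ ^ 2 + 1 / 2 * ‖y - p‖ ^ 2 - (f y + 1 / 2 * ‖u - y‖ ^ 2) with he
  have he0 : 0 < e := by linarith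
  have hq : 0 ≤ ‖y - p‖ ^ 2 := sq_nonneg _
  -- So small a `t` makes the missing term `t / 2 * ‖y - p‖ ^ 2` smaller than the assumed violation
  -- `e`.
  set t := min 1 (e / (‖y - p‖ ^ 2 + 1)) with ht
  have ht0 : 0 < t := lt_min one_pos (by positivity)
  have h1 := key t ht0 (min_le_left _ _)
  have h2 : t * (‖y - p‖ ^ 2 + 1) ≤ e := by
    rw [← le_div_iff₀ (by positivity)]
    exact min_le_right _ _
  nlinarith

/-! ### The proximal gradient algorithm on the feasible set -/

namespace CIMBS

variable {V : Type*} {d : ℕ}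

/-- The standing assumptions on the feasible set and the cost function. -/
structure IsFeasibleSetting (I : CIMBS V d) (Lc : ℝ≥0) : Prop where
  subset : I.domain ⊆ nonnegOrthant d
  convex : ConvexOn ℝ I.domain I.c
  lip : LipschitzOnWith Lc I.c I.domain
  lam_nonneg : 0 ≤ I.lam
  compact : IsCompact I.feasible
  nonempty : I.feasible.Nonempty

section Feasible

variable {I : CIMBS V d} {Lc : ℝ≥0} {x y : Strategy d}

theorem IsFeasibleSetting.nonneg (hF : I.IsFeasibleSetting Lc) (hx : x ∈ I.feasible) :
    x ∈ nonnegOrthant d := hF.subset hx.1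

theorem IsFeasibleSetting.convex_feasible (hF : I.IsFeasibleSetting Lc) :
    Convex ℝ I.feasible := hF.convex.convex_le I.k

theorem IsFeasibleSetting.s_nonneg (hF : I.IsFeasibleSetting Lc) (hx : x ∈ I.feasible) :
    0 ≤ I.s x := mul_nonneg hF.lam_nonneg (sub_nonneg.2 hx.2)

theorem IsFeasibleSetting.abs_s_sub_le (hF : I.IsFeasibleSetting Lc) (hx : x ∈ I.feasible)
    (hy : y ∈ I.feasible) : |I.s x - I.s y| ≤ I.lam * Lc * ‖x - y‖ := by
  have h := hF.lip.dist_le_mul x hx.1 y hy.1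
  rw [Real.dist_eq, dist_eq_norm] at h
  have h2 : I.s x - I.s y = I.lam * (I.c y - I.c x) := by
    simp only [s]
    ring
  rw [h2, abs_mul, abs_of_nonneg hF.lam_nonneg, abs_sub_comm, mul_assoc]
  exact mul_le_mul_of_nonneg_left h hF.lam_nonneg

theorem IsFeasibleSetting.continuousOn_s (hF : I.IsFeasibleSetting Lc) :
    ContinuousOn I.s I.feasible :=
  continuousOn_const.mul
    (continuousOn_const.sub (hF.lip.continuousOn.mono fun _ hx => hx.1))

theorem IsFeasibleSetting.convexOn_neg_mul_s (hF : I.IsFeasibleSetting Lc) {η : ℝ}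
    (hη : 0 ≤ η) : ConvexOn ℝ I.feasible fun z => -η * I.s z := by
  have h := ((hF.convex.subset (fun _ hx => hx.1) hF.convex_feasible).smul
    (mul_nonneg hη hF.lam_nonneg)).add_const (-(η * I.lam * I.k))
  refine h.congr fun z _ => ?_
  simp only [s, Pi.add_apply, smul_eq_mul]
  ring

theorem IsFeasibleSetting.prox_spec (hF : I.IsFeasibleSetting Lc) (η : ℝ) (x : Strategy d) :
    I.prox η x ∈ I.feasible ∧
      IsMinOn (fun z => -η * I.s z + 1 / 2 * ‖x - z‖ ^ 2) I.feasible (I.prox η x) := by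
  refine Classical.epsilon_spec (p := fun y => y ∈ I.feasible ∧
    IsMinOn (fun z => -η * I.s z + 1 / 2 * ‖x - z‖ ^ 2) I.feasible y) ?_
  refine hF.compact.exists_isMinOn hF.nonempty ?_
  exact (continuousOn_const.mul hF.continuousOn_s).add
    (Continuous.continuousOn (by fun_prop))

variable [Fintype V] [DecidableEq V]

theorem IsFeasibleSetting.iterate_mem (hF : I.IsFeasibleSetting Lc) (hx : x ∈ I.feasible)
    (Rs : List (Finset V)) (η : ℝ) (t : ℕ) : I.iterate Rs η x t ∈ I.feasible := by
  cases t with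
  | zero => exact hx
  | succ t => exact (hF.prox_spec _ _).1

variable {p : ProxGradInput d}

theorem IsFeasibleSetting.proxGrad_mem (hF : I.IsFeasibleSetting Lc) (hx0 : p.x0 ∈ I.feasible)
    (Rs : List (Finset V)) (err : ℝ) : I.proxGrad p Rs err ∈ I.feasible :=
  hF.iterate_mem hx0 _ _ _

theorem le_proxGrad (Rs : List (Finset V)) (err : ℝ) {t : ℕ} (ht : t ≤ numSteps p Rs err) :
    I.gHat Rs (I.iterate Rs (1 / betaHat p Rs) p.x0 t) +
        I.s (I.iterate Rs (1 / betaHat p Rs) p.x0 t) ≤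
      I.gHat Rs (I.proxGrad p Rs err) + I.s (I.proxGrad p Rs err) :=
  (Classical.choose_spec (Finset.exists_max_image (Finset.range (numSteps p Rs err + 1))
        (fun t => I.gHat Rs (I.iterate Rs (1 / betaHat p Rs) p.x0 t) +
          I.s (I.iterate Rs (1 / betaHat p Rs) p.x0 t))
        Finset.nonempty_range_add_one)).2 t (Finset.mem_range.2 (Nat.lt_succ_of_le ht))

/-- One proximal gradient step, compared with a feasible point `y`. -/
theorem IsFeasibleSetting.prox_step (hF : I.IsFeasibleSetting Lc)
    (hI : I.IsRegular p.Lh p.βh) {Rs : List (Finset V)} (hβ : 0 < betaHat p Rs)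
    (hx : x ∈ I.feasible) (hy : y ∈ I.feasible) {x' : Strategy d}
    (hx' : x' = I.prox (1 / betaHat p Rs) (x + (1 / betaHat p Rs) • I.gradGHat Rs x)) :
    I.gHat Rs x + I.s y + inner ℝ (I.gradGHat Rs x) (y - x) -
        betaHat p Rs / 2 * (‖y - x‖ ^ 2 - ‖y - x'‖ ^ 2) ≤ I.gHat Rs x' + I.s x' := by
  set β := betaHat p Rs with hβdef
  set γ := I.gradGHat Rs x
  obtain ⟨hm, hmin⟩ := hF.prox_spec (1 / β) (x + (1 / β) • γ)
  rw [← hx'] at hm hmin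
  have h1 := add_half_sq_dist_le_of_isMinOn hF.convex_feasible
    (hF.convexOn_neg_mul_s (one_div_pos.2 hβ).le) hm hmin hy
  have hexp : ∀ z : Strategy d, 1 / 2 * ‖x + (1 / β) • γ - z‖ ^ 2 =
      1 / 2 * ‖z - x‖ ^ 2 - 1 / β * inner ℝ γ (z - x) + 1 / 2 * ((1 / β) ^ 2 * ‖γ‖ ^ 2) := by
    intro z
    have e1 : x + (1 / β) • γ - z = (1 / β) • γ - (z - x) := by abel
    rw [e1, norm_sub_sq_real, norm_smul, real_inner_smul_left, mul_pow, Real.norm_eq_abs, sq_abs]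
    ring
  rw [hexp, hexp] at h1
  have h2 := hI.gHat_quadratic_lower (hF.nonneg hx) (hF.nonneg hm) Rs
  have h3 : β * (1 / β) = 1 := mul_one_div_cancel hβ.ne'
  have h4 := mul_le_mul_of_nonneg_left h1 hβ.le
  have h5 : ∀ a b c e : ℝ, β * (-(1 / β) * a + (1 / 2 * b - 1 / β * c + e)) =
      -a + β / 2 * b - c + β * e := fun a b c e => by
    linear_combination (-a - c) * h3
  rw [mul_add, h5, h5] at h4
  linarith

/-- The approximation guarantee of the proximal gradient algorithm. -/
theorem IsFeasibleSetting.half_sub_le_proxGrad (hF : I.IsFeasibleSetting Lc)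
    (hI : I.IsRegular p.Lh p.βh) (hx0 : p.x0 ∈ I.feasible)
    (hΔ : ∀ x ∈ I.feasible, ∀ y ∈ I.feasible, dist x y ≤ p.Δ)
    {Rs : List (Finset V)} (hβ : 0 < betaHat p Rs) {err : ℝ} (herr : 0 < err)
    (hy : y ∈ I.feasible) :
    (I.gHat Rs y + I.s y) / 2 - 5 / 18 * err ≤
      I.gHat Rs (I.proxGrad p Rs err) + I.s (I.proxGrad p Rs err) := by
  set β := betaHat p Rs with hβdef
  set X : ℕ → Strategy d := I.iterate Rs (1 / β) p.x0 with hX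
  set T := numSteps p Rs err with hT
  have hmem : ∀ t, X t ∈ I.feasible := hF.iterate_mem hx0 Rs _
  have hΔ0 : 0 ≤ p.Δ := dist_nonneg.trans (hΔ _ hx0 _ hx0)
  -- With `b = β / 2` below, the rate lemma bounds the gap by `5/24 * β * Δ ^ 2 / T`, hence by `5/18
  -- * err`.
  have hceil : 3 * β * p.Δ ^ 2 / (4 * err) ≤ T := Nat.le_ceil _
  rw [div_le_iff₀ (by positivity)] at hceil
  have hgap := gap_le_of_telescoping (G := fun t => (I.gHat Rs y + I.s y) / 2 -
      (I.gHat Rs (X t) + I.s (X t))) (D := fun t => ‖y - X t‖) (s := fun t => ‖X t - X (t + 1)‖)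
      (b := β / 2) (Δ := p.Δ) T (by positivity) ?_ ?_ ?_ (fun _ _ => norm_nonneg _)
      (fun t _ => by rw [← dist_eq_norm]; exact hΔ _ hy _ (hmem t))
  · have hT' := le_proxGrad (I := I) (p := p) Rs err (t := T) le_rfl
    rw [← hβdef] at hT'
    rcases Nat.eq_zero_or_pos T with h0 | h0
    -- Zero steps are prescribed only if `Δ = 0`; then the feasible set is a single point.
    · rw [h0, Nat.cast_zero, zero_mul] at hceil
      have hΔz : p.Δ = 0 := by
        by_contra hne
        have : 0 < p.Δ := lt_of_le_of_ne hΔ0 (Ne.symm hne)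
        have : 0 < 3 * β * p.Δ ^ 2 := by positivity
        linarith
      have hyx : y = p.x0 := dist_le_zero.1 (hΔz ▸ hΔ _ hy _ hx0)
      have hX0 : X T = y := by rw [h0, hyx]; rfl
      change I.gHat Rs (X T) + I.s (X T) ≤ _ at hT'
      rw [hX0] at hT'
      linarith [hI.gHat_nonneg (hF.nonneg hy) Rs, hF.s_nonneg hy]
    · have hTpos : (0 : ℝ) < T := Nat.cast_pos.2 h0
      have h1 : (T : ℝ) * ((I.gHat Rs y + I.s y) / 2 - (I.gHat Rs (X T) + I.s (X T))) ≤
          T * (5 / 18 * err) := by linarith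
      have h2 := le_of_mul_le_mul_left h1 hTpos
      change I.gHat Rs (X T) + I.s (X T) ≤ _ at hT'
      linarith
  · intro t _
    have h1 := hF.prox_step hI hβ (hmem t) hy (x' := X (t + 1)) rfl
    have h2 := hI.gHat_sub_two_mul_le (hF.nonneg (hmem t)) (hF.nonneg hy) Rs
    have h3 := hF.s_nonneg (hmem t)
    linarith
  -- A step compared with its own starting point gives the sufficient increase of the objective.
  · intro t _
    have h1 := hF.prox_step hI hβ (hmem t) (hmem t) (x' := X (t + 1)) rfl
    simp only [sub_self, inner_zero_right, norm_zero] at h1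
    linarith
  · intro t _
    have := norm_sub_norm_le (y - X t) (y - X (t + 1))
    rw [sub_sub_sub_cancel_left, norm_sub_rev (X (t + 1))] at this
    exact this

end Feasible

end CIMBS

/-! ### Nets inside the feasible set -/

section Covering

variable {d : ℕ}

/-- Covers of a closed convex set of a Euclidean space can be moved into the set. -/
theorem Convex.exists_subset_isCover {K : Set (Strategy d)} (hK : Convex ℝ K) (hKc : IsClosed K)
    (hne : K.Nonempty) {C : Set (Strategy d)} {r : ℝ≥0} (hC : Metric.IsCover r K C) :
    ∃ C' ⊆ K, Metric.IsCover r K C' ∧ C'.encard ≤ C.encard := by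
  have hproj : ∀ u : Strategy d, ∃ v ∈ K, ∀ w ∈ K, inner ℝ (u - v) (w - v) ≤ 0 := fun u => by
    obtain ⟨v, hv, h⟩ := exists_norm_eq_iInf_of_complete_convex hne hKc.isComplete hK u
    exact ⟨v, hv, (norm_eq_iInf_iff_real_inner_le_zero hK hv).1 h⟩
  choose π hπ hπi using hproj
  refine ⟨π '' C, by rintro _ ⟨u, -, rfl⟩; exact hπ u, ?_, Set.encard_image_le _ _⟩
  rw [Metric.isCover_iff_subset_iUnion_closedBall] at hC ⊢
  intro x hx
  obtain ⟨u, hu, hxu⟩ := Set.mem_iUnion₂.1 (hC hx)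
  refine Set.mem_iUnion₂.2 ⟨π u, ⟨u, hu, rfl⟩, ?_⟩
  rw [Metric.mem_closedBall, dist_eq_norm] at hxu ⊢
  refine le_trans ?_ hxu
  -- The angle at the projection `π u` is not acute, so `π u` is at least as close to every `x ∈ K`
  -- as `u` is.
  have h1 := norm_sub_sq_real (x - π u) (u - π u)
  rw [sub_sub_sub_cancel_right, real_inner_comm] at h1
  have h2 : ‖x - π u‖ ^ 2 ≤ ‖x - u‖ ^ 2 := by linarith [hπi u x hx, sq_nonneg ‖u - π u‖]
  exact (sq_le_sq₀ (norm_nonneg _) (norm_nonneg _)).1 h2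

end Covering

namespace CIMBS

variable {V : Type*} {d : ℕ} {I : CIMBS V d} {Lc : ℝ≥0}

theorem IsFeasibleSetting.externalCoveringNumber_ne_top (hF : I.IsFeasibleSetting Lc) {r : ℝ}
    (hr : 0 < r) : Metric.externalCoveringNumber r.toNNReal I.feasible ≠ ⊤ := by
  obtain ⟨N, -, hfin, hN⟩ := Metric.exists_finite_isCover_of_totallyBounded
    (Real.toNNReal_pos.2 hr).ne' hF.compact.totallyBounded
  exact ne_top_of_le_ne_top hfin.encard_lt_top.ne hN.externalCoveringNumber_le_encard

/-- The centres must be feasible, since the Lipschitz bounds and `g + s ≤ OPT` are used at them.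
Projection achieves this without increasing the external covering number. -/
theorem IsFeasibleSetting.exists_net [DecidableEq V] [Fintype V] (hF : I.IsFeasibleSetting Lc)
    {r : ℝ} (hr : 0 < r) :
    ∃ N : Finset (Strategy d), (∀ z ∈ N, z ∈ I.feasible) ∧ (N.card : ℝ) ≤ I.covNum r ∧
      ∀ y ∈ I.feasible, ∃ z ∈ N, ‖y - z‖ ≤ r := by
  have htop := hF.externalCoveringNumber_ne_top hr
  obtain ⟨C, hC, hCcard⟩ : ∃ C, Metric.IsCover r.toNNReal I.feasible C ∧
      C.encard = Metric.externalCoveringNumber r.toNNReal I.feasible := by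
    have : Nonempty {C : Set (Strategy d) // Metric.IsCover r.toNNReal I.feasible C} :=
      ⟨⟨I.feasible, Metric.IsCover.rfl⟩⟩
    obtain ⟨C, hC⟩ := ENat.exists_eq_iInf
      (fun C : {C : Set (Strategy d) // Metric.IsCover r.toNNReal I.feasible C} => C.1.encard)
    exact ⟨C.1, C.2, by rw [hC, Metric.externalCoveringNumber, iInf_subtype]⟩
  obtain ⟨C', hsub, hcov, hcard⟩ :=
    hF.convex_feasible.exists_subset_isCover hF.compact.isClosed hF.nonempty hC
  rw [hCcard] at hcard
  have hfin : C'.Finite := Set.encard_ne_top_iff.1 (ne_top_of_le_ne_top htop hcard)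
  refine ⟨hfin.toFinset, fun z hz => hsub (hfin.mem_toFinset.1 hz), ?_, fun y hy => ?_⟩
  · rw [covNum, Nat.cast_le, ← Set.ncard_eq_toFinset_card C' hfin, Set.ncard]
    exact ENat.toNat_le_toNat hcard htop
  · rw [Metric.isCover_iff_subset_iUnion_closedBall] at hcov
    obtain ⟨z, hz, hyz⟩ := Set.mem_iUnion₂.1 (hcov hy)
    refine ⟨z, hfin.mem_toFinset.2 hz, ?_⟩
    rwa [Metric.mem_closedBall, dist_eq_norm, Real.coe_toNNReal _ hr.le] at hyz

theorem IsFeasibleSetting.covNum_anti [DecidableEq V] [Fintype V]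
    (hF : I.IsFeasibleSetting Lc) {r r' : ℝ} (hr : 0 < r) (h : r ≤ r') :
    I.covNum r' ≤ I.covNum r := by
  rw [covNum, covNum, Nat.cast_le]
  exact ENat.toNat_le_toNat (Metric.externalCoveringNumber_anti (Real.toNNReal_le_toNNReal h))
    (hF.externalCoveringNumber_ne_top hr)

theorem IsFeasibleSetting.one_le_covNum [DecidableEq V] [Fintype V]
    (hF : I.IsFeasibleSetting Lc) {r : ℝ} (hr : 0 < r) : 1 ≤ I.covNum r := by
  rw [covNum, Nat.one_le_cast, Nat.one_le_iff_ne_zero, ne_eq, ENat.toNat_eq_zero]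
  push Not
  exact ⟨(Metric.externalCoveringNumber_pos_iff.2 hF.nonempty).ne',
    hF.externalCoveringNumber_ne_top hr⟩

end CIMBS

/-! ### Union bounds and tails of the estimator -/

namespace PMF

variable {α β : Type*}

theorem expect_comm (p : PMF α) (q : PMF β) (f : α → β → ℝ≥0∞) :
    (p.expect fun a => q.expect fun b => f a b) = q.expect fun b => p.expect fun a => f a b := by
  simp only [expect, ← ENNReal.tsum_mul_left]
  rw [ENNReal.tsum_comm]
  exact tsum_congr fun b => tsum_congr fun a => by ring

theorem toOuterMeasure_exists_mem_le (p : PMF α) (N : Finset β) (A : β → Set α) {c : ℝ≥0∞}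
    (h : ∀ z ∈ N, p.toOuterMeasure (A z) ≤ c) :
    p.toOuterMeasure {a | ∃ z ∈ N, a ∈ A z} ≤ N.card * c := by
  have : {a | ∃ z ∈ N, a ∈ A z} = ⋃ z ∈ N, A z := by
    ext a
    simp
  rw [this]
  refine (MeasureTheory.measure_biUnion_finset_le N A).trans ?_
  rw [← nsmul_eq_mul]
  exact Finset.sum_le_card_nsmul _ _ _ h

end PMF

namespace CIMBS

variable {V : Type*} [Fintype V] [DecidableEq V] [Nonempty V] {d : ℕ} {I : CIMBS V d}
  {p : ProxGradInput d} {x y : Strategy d} {L β Lc : ℝ≥0}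

section Tails

theorem IsRegular.gHat_upper_tail (hI : I.IsRegular L β) (hx : x ∈ nonnegOrthant d) (m : ℕ)
    {G t : ℝ} (hG : I.g x ≤ G) (hG0 : 0 < G) (ht : 0 ≤ t) :
    (I.model.rrSamples m).toOuterMeasure {l | I.g x + t ≤ I.gHat l x} ≤
      ENNReal.ofReal (Real.exp (-(m * t ^ 2 / (Fintype.card V * (2 * G + 2 / 3 * t))))) := by
  have hn : (0 : ℝ) < Fintype.card V := by exact_mod_cast Fintype.card_pos
  -- Without samples the estimator divides by zero, but the claimed bound is then the trivial value
  -- 1.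
  rcases Nat.eq_zero_or_pos m with rfl | hm
  · simpa using PMF.toOuterMeasure_le_one _ _
  have hm' : (0 : ℝ) < m := Nat.cast_pos.2 hm
  have hg := I.g_eq_card_mul_rrMean x
  refine (PMF.toOuterMeasure_mono _ (t := {l | m * (I.model.rrMean (I.coverage x) +
    t / Fintype.card V) ≤ (l.map (I.coverage x)).sum}) ?_).trans
    ((I.model.rrSamples_upper_tail (hI.coverage_nonneg hx) (hI.coverage_le_one hx) m
      (μ := G / Fintype.card V) (t := t / Fintype.card V) ?_ (by positivity)
      (by positivity)).trans (le_of_eq ?_))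
  · rintro l ⟨hl, hlm⟩
    have hl' : I.g x + t ≤ I.gHat l x := hl
    rw [gHat_eq, I.model.length_of_mem_support_rrSamples hlm, hg, div_mul_eq_mul_div,
      le_div_iff₀ hm'] at hl'
    refine le_of_mul_le_mul_left (le_trans (le_of_eq ?_) hl') hn
    field_simp
  · rw [le_div_iff₀ hn]
    linarith
  · congr 3
    field_simp

theorem IsRegular.gHat_lower_tail (hI : I.IsRegular L β) (hx : x ∈ nonnegOrthant d) {m : ℕ}
    {G t : ℝ} (hG : I.g x ≤ G) (hG0 : 0 < G) (ht : 0 ≤ t) :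
    (I.model.rrSamples m).toOuterMeasure {l | I.gHat l x ≤ I.g x - t} ≤
      ENNReal.ofReal (Real.exp (-(m * t ^ 2 / (Fintype.card V * (2 * G))))) := by
  have hn : (0 : ℝ) < Fintype.card V := by exact_mod_cast Fintype.card_pos
  rcases Nat.eq_zero_or_pos m with rfl | hm
  · simpa using PMF.toOuterMeasure_le_one _ _
  have hm' : (0 : ℝ) < m := Nat.cast_pos.2 hm
  have hg := I.g_eq_card_mul_rrMean x
  refine (PMF.toOuterMeasure_mono _ (t := {l | (l.map (I.coverage x)).sum ≤
    m * (I.model.rrMean (I.coverage x) - t / Fintype.card V)}) ?_).trans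
    ((I.model.rrSamples_lower_tail (hI.coverage_nonneg hx) (hI.coverage_le_one hx) m
      (μ := G / Fintype.card V) (t := t / Fintype.card V) ?_ (by positivity)
      (by positivity)).trans (le_of_eq ?_))
  · rintro l ⟨hl, hlm⟩
    have hl' : I.gHat l x ≤ I.g x - t := hl
    rw [gHat_eq, I.model.length_of_mem_support_rrSamples hlm, hg, div_mul_eq_mul_div,
      div_le_iff₀ hm'] at hl'
    refine le_of_mul_le_mul_left (le_trans hl' (le_of_eq ?_)) hn
    field_simp
  · rw [le_div_iff₀ hn]
    linarith
  · congr 3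
    field_simp

end Tails

section Objective

theorem IsFeasibleSetting.lip_pos (hF : I.IsFeasibleSetting p.Lc) (hLh : 0 < p.Lh) :
    0 < I.lip p := by
  have hn : (0 : ℝ) < Fintype.card V := by exact_mod_cast Fintype.card_pos
  have h1 : (0 : ℝ) < p.Lh := hLh
  have h2 := mul_nonneg hF.lam_nonneg p.Lc.2
  exact add_pos_of_pos_of_nonneg (by positivity) h2

theorem IsFeasibleSetting.gHat_add_s_le (hF : I.IsFeasibleSetting p.Lc)
    (hI : I.IsRegular p.Lh p.βh) (Rs : List (Finset V)) (hx : x ∈ I.feasible)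
    (hy : y ∈ I.feasible) :
    I.gHat Rs x + I.s x ≤ I.gHat Rs y + I.s y + I.lip p * ‖x - y‖ := by
  have h1 := (abs_le.1 (hI.abs_gHat_sub_le (hF.nonneg hx) (hF.nonneg hy) Rs)).2
  have h2 := (abs_le.1 (hF.abs_s_sub_le hx hy)).2
  rw [CIMBS.lip]
  linarith

theorem IsFeasibleSetting.g_add_s_le (hF : I.IsFeasibleSetting p.Lc)
    (hI : I.IsRegular p.Lh p.βh) (hx : x ∈ I.feasible) (hy : y ∈ I.feasible) :
    I.g x + I.s x ≤ I.g y + I.s y + I.lip p * ‖x - y‖ := by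
  have h1 := (abs_le.1 (hI.abs_g_sub_le (hF.nonneg hx) (hF.nonneg hy))).2
  have h2 := (abs_le.1 (hF.abs_s_sub_le hx hy)).2
  rw [CIMBS.lip]
  linarith

theorem IsFeasibleSetting.exists_isMax (hF : I.IsFeasibleSetting p.Lc)
    (hI : I.IsRegular p.Lh p.βh) :
    ∃ z ∈ I.feasible, I.g z + I.s z = I.opt ∧ ∀ y ∈ I.feasible, I.g y + I.s y ≤ I.opt := by
  have hcont : ContinuousOn (fun z => I.g z + I.s z) I.feasible := by
    refine (LipschitzOnWith.of_le_add_mul (Real.toNNReal (I.lip p)) fun a ha b hb => ?_).continuousOn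
    refine (hF.g_add_s_le hI ha hb).trans ?_
    rw [dist_eq_norm]
    gcongr
    exact Real.le_coe_toNNReal _
  obtain ⟨z, hz, hmax⟩ := hF.compact.exists_isMaxOn hF.nonempty hcont
  have hopt : I.g z + I.s z = I.opt :=
    (IsGreatest.csSup_eq (s := (fun z => I.g z + I.s z) '' I.feasible)
      ⟨⟨z, hz, rfl⟩, by rintro _ ⟨y, hy, rfl⟩; exact hmax hy⟩).symm
  exact ⟨z, hz, hopt, fun y hy => hopt ▸ hmax hy⟩

end Objective

/-! ### Correctness of the estimate `LB` -/

section LowerBoundLoop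

/-- The event that the estimator exceeds `max OPT x_i` by the factor `1 + ε' + ε / 3` somewhere. -/
def overestimated (I : CIMBS V d) (p : ProxGradInput d) (i : ℕ) : Set (List (Finset V)) :=
  {Rs | ∃ y ∈ I.feasible,
    (1 + epsPrime p + p.eps / 3) * max I.opt (I.guess i) ≤ I.gHat Rs y + I.s y}

theorem epsPrime_pos (heps : 0 < p.eps) : 0 < epsPrime p := by
  unfold epsPrime
  positivity

theorem IsFeasibleSetting.base_pos (hF : I.IsFeasibleSetting p.Lc) (hk : 0 ≤ I.k) :
    0 < (Fintype.card V : ℝ) + I.lam * I.k :=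
  add_pos_of_pos_of_nonneg (by exact_mod_cast Fintype.card_pos) (mul_nonneg hF.lam_nonneg hk)

theorem IsFeasibleSetting.guess_pos (hF : I.IsFeasibleSetting p.Lc) (hk : 0 ≤ I.k) (i : ℕ) :
    0 < I.guess i := div_pos (hF.base_pos hk) (by positivity)

theorem two_le_logb_of_rounds_pos (h : 1 ≤ I.rounds) :
    2 ≤ Real.logb 2 ((Fintype.card V : ℝ) + I.lam * I.k) := by
  have := (Nat.le_floor_iff' one_ne_zero).1 h
  push_cast at this
  linarith

theorem rounds_le_logb (h : 1 ≤ I.rounds) :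
    (I.rounds : ℝ) ≤ Real.logb 2 ((Fintype.card V : ℝ) + I.lam * I.k) := by
  have h2 := two_le_logb_of_rounds_pos h
  have := Nat.floor_le (a := Real.logb 2 ((Fintype.card V : ℝ) + I.lam * I.k) - 1) (by linarith)
  rw [rounds]
  linarith

/-- The logarithmic factor of `θ_i`. -/
noncomputable def logFactor (I : CIMBS V d) (p : ProxGradInput d) (i : ℕ) : ℝ :=
  Real.log (I.covNum (p.eps / 3 / I.lip p * I.guess i)) +
    p.ell * Real.log (Fintype.card V : ℝ) + Real.log 2 +
      Real.log (Real.logb 2 ((Fintype.card V : ℝ) + I.lam * I.k))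

theorem one_le_card_real : (1 : ℝ) ≤ Fintype.card V := by exact_mod_cast Fintype.card_pos

theorem IsFeasibleSetting.radius_pos (hF : I.IsFeasibleSetting p.Lc) (hLh : 0 < p.Lh)
    (hk : 0 ≤ I.k) (heps : 0 < p.eps) (i : ℕ) : 0 < p.eps / 3 / I.lip p * I.guess i :=
  mul_pos (div_pos (by positivity) (hF.lip_pos hLh)) (hF.guess_pos hk i)

theorem IsFeasibleSetting.logFactor_nonneg (hF : I.IsFeasibleSetting p.Lc) (hLh : 0 < p.Lh)
    (hk : 0 ≤ I.k) (heps : 0 < p.eps) (hell : 0 < p.ell) (hr : 1 ≤ I.rounds) (i : ℕ) :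
    0 ≤ I.logFactor p i := by
  have h1 := Real.log_nonneg (hF.one_le_covNum (hF.radius_pos hLh hk heps i))
  have h2 := mul_nonneg hell.le (Real.log_nonneg (one_le_card_real (V := V)))
  have h3 := Real.log_nonneg (one_le_two : (1 : ℝ) ≤ 2)
  have h4 := Real.log_nonneg (one_le_two.trans (two_le_logb_of_rounds_pos hr))
  unfold logFactor
  linarith

theorem IsFeasibleSetting.exp_neg_logFactor (hF : I.IsFeasibleSetting p.Lc) (hLh : 0 < p.Lh)
    (hk : 0 ≤ I.k) (heps : 0 < p.eps) (hr : 1 ≤ I.rounds) (i : ℕ) :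
    I.covNum (p.eps / 3 / I.lip p * I.guess i) * Real.exp (-I.logFactor p i) =
      1 / (2 * (Fintype.card V : ℝ) ^ p.ell *
        Real.logb 2 ((Fintype.card V : ℝ) + I.lam * I.k)) := by
  have h1 := one_pos.trans_le (hF.one_le_covNum (hF.radius_pos hLh hk heps i))
  have h2 : (0 : ℝ) < Fintype.card V := one_pos.trans_le one_le_card_real
  have h4 := two_pos.trans_le (two_le_logb_of_rounds_pos hr)
  rw [Real.exp_neg, logFactor, Real.exp_add, Real.exp_add, Real.exp_add, Real.exp_log h1,
    Real.exp_log h4, Real.exp_log two_pos, mul_comm p.ell, ← Real.rpow_def_of_pos h2]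
  have := Real.rpow_pos_of_pos h2 p.ell
  generalize I.covNum (p.eps / 3 / I.lip p * I.guess i) = N at h1
  field_simp

theorem theta_eq {i : ℕ} (hi : i ≠ 0) :
    I.theta p i = ⌈(Fintype.card V : ℝ) * (2 + 2 / 3 * epsPrime p) * I.logFactor p i /
      (epsPrime p ^ 2 * I.guess i)⌉₊ := by
  rw [theta, if_neg hi, logFactor]

theorem IsFeasibleSetting.theta_le_succ (hF : I.IsFeasibleSetting p.Lc) (hLh : 0 < p.Lh)
    (hk : 0 ≤ I.k) (heps : 0 < p.eps) (hell : 0 < p.ell) (hr : 1 ≤ I.rounds) (i : ℕ) :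
    I.theta p i ≤ I.theta p (i + 1) := by
  rcases Nat.eq_zero_or_pos i with rfl | hi
  · simp [theta]
  rw [theta_eq hi.ne', theta_eq i.succ_ne_zero]
  refine Nat.ceil_le_ceil ?_
  have he := epsPrime_pos heps
  have hguess : I.guess (i + 1) ≤ I.guess i := by
    unfold guess
    have := (hF.base_pos hk).le
    gcongr
    · norm_num
    · omega
  have hpos := hF.guess_pos hk (i + 1)
  have hlog : I.logFactor p i ≤ I.logFactor p (i + 1) := by
    unfold logFactor
    have hlip := hF.lip_pos hLh
    have h1 := hF.one_le_covNum (hF.radius_pos hLh hk heps i)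
    have h2 := hF.covNum_anti (hF.radius_pos hLh hk heps (i + 1))
      (r' := p.eps / 3 / I.lip p * I.guess i) (by gcongr)
    have := Real.log_le_log (by linarith) h2
    linarith
  have h0 := hF.logFactor_nonneg hLh hk heps hell hr i
  have h1 := h0.trans hlog
  rw [Nat.succ_eq_add_one]
  gcongr

/-- The margin `ε/3` pays for moving to a net point, the margin `ε'` is a deviation at that point,
and `logFactor` absorbs the size of the net. -/
theorem IsFeasibleSetting.overestimated_le (hF : I.IsFeasibleSetting p.Lc)
    (hI : I.IsRegular p.Lh p.βh) (hLh : 0 < p.Lh) (hk : 0 ≤ I.k) (heps : 0 < p.eps)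
    (hr : 1 ≤ I.rounds) {i : ℕ} (hi : i ≠ 0) :
    (I.model.rrSamples (I.theta p i)).toOuterMeasure (I.overestimated p i) ≤
      ENNReal.ofReal (1 / (2 * (Fintype.card V : ℝ) ^ p.ell *
        Real.logb 2 ((Fintype.card V : ℝ) + I.lam * I.k))) := by
  -- `B` serves both purposes of the test: it bounds `g + s` on the feasible set, and `B ≥ x_i` lets
  -- `θ_i` samples suffice for a deviation `ε' * B`.
  set B := max I.opt (I.guess i) with hB
  have hx := hF.guess_pos hk i
  have hxB : I.guess i ≤ B := le_max_right _ _
  have hB0 : 0 < B := hx.trans_le hxB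
  have he := epsPrime_pos heps
  have hlip := hF.lip_pos hLh
  have hn : (0 : ℝ) < Fintype.card V := one_pos.trans_le one_le_card_real
  obtain ⟨N, hN, hcard, hnet⟩ := hF.exists_net (hF.radius_pos hLh hk heps i)
  obtain ⟨-, -, -, hopt⟩ := hF.exists_isMax hI
  calc (I.model.rrSamples (I.theta p i)).toOuterMeasure (I.overestimated p i)
      ≤ (I.model.rrSamples (I.theta p i)).toOuterMeasure
          {Rs | ∃ z ∈ N, Rs ∈ {Rs | I.g z + epsPrime p * B ≤ I.gHat Rs z}} := by
        refine MeasureTheory.measure_mono ?_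
        rintro Rs ⟨y, hy, hyB⟩
        obtain ⟨z, hz, hyz⟩ := hnet y hy
        refine ⟨z, hz, ?_⟩
        have h1 := hF.gHat_add_s_le hI Rs hy (hN z hz)
        have h2 : I.lip p * ‖y - z‖ ≤ p.eps / 3 * I.guess i := by
          refine (mul_le_mul_of_nonneg_left hyz hlip.le).trans (le_of_eq ?_)
          field_simp
        have h3 : p.eps / 3 * I.guess i ≤ p.eps / 3 * B := by gcongr
        have h4 : I.g z + I.s z ≤ B := (hopt z (hN z hz)).trans (le_max_left _ _)
        change I.g z + epsPrime p * B ≤ I.gHat Rs z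
        linarith
    _ ≤ N.card * ENNReal.ofReal (Real.exp (-I.logFactor p i)) := by
        refine PMF.toOuterMeasure_exists_mem_le _ _ _ fun z hz => ?_
        have hgB : I.g z ≤ B := by
          have h4 : I.g z + I.s z ≤ B := (hopt z (hN z hz)).trans (le_max_left _ _)
          linarith [hF.s_nonneg (hN z hz)]
        refine (hI.gHat_upper_tail (hF.nonneg (hN z hz)) _ hgB hB0 (by positivity)).trans
          (ENNReal.ofReal_le_ofReal (Real.exp_le_exp.2 (neg_le_neg ?_)))
        have hθ : (Fintype.card V : ℝ) * (2 + 2 / 3 * epsPrime p) * I.logFactor p i /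
            (epsPrime p ^ 2 * I.guess i) ≤ I.theta p i := by
          rw [theta_eq hi]
          exact Nat.le_ceil _
        rw [div_le_iff₀ (by positivity)] at hθ
        have e1 : (Fintype.card V : ℝ) * (2 * B + 2 / 3 * (epsPrime p * B)) =
            Fintype.card V * (2 + 2 / 3 * epsPrime p) * B := by ring
        rw [e1, le_div_iff₀ (by positivity)]
        have h5 := mul_le_mul_of_nonneg_right hθ hB0.le
        have h6 : (I.theta p i : ℝ) * (epsPrime p ^ 2 * I.guess i) * B ≤
            I.theta p i * (epsPrime p ^ 2 * B) * B := by gcongr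
        linarith
    _ ≤ ENNReal.ofReal (I.covNum (p.eps / 3 / I.lip p * I.guess i)) *
          ENNReal.ofReal (Real.exp (-I.logFactor p i)) := by
        gcongr
        rw [← ENNReal.ofReal_natCast]
        exact ENNReal.ofReal_le_ofReal hcard
    _ = _ := by
        rw [← ENNReal.ofReal_mul (zero_le_one.trans
          (hF.one_le_covNum (hF.radius_pos hLh hk heps i))),
          hF.exp_neg_logFactor hLh hk heps hr]

/-- The rounds share RR sets and continuing depends on them, so conditioning on failed tests is
avoided: the bound is averaged over an unconditioned list of `θ_i` RR sets, and each remaining round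
adds only the probability of its own overestimation. -/
theorem IsFeasibleSetting.expect_lbLoop_le (hF : I.IsFeasibleSetting p.Lc)
    (hI : I.IsRegular p.Lh p.βh) (hx0 : p.x0 ∈ I.feasible) (hLh : 0 < p.Lh) (hk : 0 ≤ I.k)
    (hopt : 1 ≤ I.opt) (heps : 0 < p.eps) (hell : 0 < p.ell) (r i : ℕ) (hri : r + i ≤ I.rounds) :
    ((I.model.rrSamples (I.theta p i)).expect fun Rs =>
        (I.lbLoop p r (i + 1) Rs).toOuterMeasure {LB | 0 < LB ∧ LB ≤ I.opt}ᶜ) ≤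
      r * ENNReal.ofReal (1 / (2 * (Fintype.card V : ℝ) ^ p.ell *
        Real.logb 2 ((Fintype.card V : ℝ) + I.lam * I.k))) := by
  induction r generalizing i with
  | zero =>
    simp only [lbLoop, PMF.toOuterMeasure_pure_apply, Set.mem_compl_iff, Set.mem_ofPred_eq, one_pos,
      hopt, and_self, not_true_eq_false, if_false, PMF.expect_const]
    exact zero_le
  | succ r ih =>
    have hr : 1 ≤ I.rounds := by omega
    set afterRound : List (Finset V) → PMF ℝ := fun Ri =>
      let y := I.proxGrad p Ri (p.eps * I.guess (i + 1) / 3)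
      let val := I.gHat Ri y + I.s y
      if (1 + epsPrime p + p.eps / 3) * I.guess (i + 1) ≤ val then
        PMF.pure (val / (1 + epsPrime p + p.eps / 3))
      else I.lbLoop p r (i + 1 + 1) Ri with hafterRound
    have hloop : ∀ Rs, I.lbLoop p (r + 1) (i + 1) Rs =
        (I.model.rrSamples (I.theta p (i + 1) - I.theta p i)).bind fun new =>
          afterRound (new ++ Rs) := fun Rs => rfl
    simp only [hloop, PMF.toOuterMeasure_bind_eq_expect]
    -- After the swap the old list is averaged inside the new one, so that `new ++ Rs` is recognised
    -- as `θ_{i+1}` independent RR sets. Monotonicity of `θ` makes the truncated subtraction exact.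
    rw [PMF.expect_comm]
    have hjoin : ∀ f : List (Finset V) → ℝ≥0∞,
        ((I.model.rrSamples (I.theta p (i + 1) - I.theta p i)).expect fun new =>
          (I.model.rrSamples (I.theta p i)).expect fun Rs => f (new ++ Rs)) =
        (I.model.rrSamples (I.theta p (i + 1))).expect f := fun f => by
      conv_rhs => rw [← Nat.sub_add_cancel (hF.theta_le_succ hLh hk heps hell hr i),
        TriggeringModel.rrSamples_add]
      simp only [PMF.expect_bind, PMF.expect_map]
    rw [hjoin fun Rs => (afterRound Rs).toOuterMeasure {LB | 0 < LB ∧ LB ≤ I.opt}ᶜ]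
    -- Without overestimation, stopping is never bad; otherwise the failure probability is that of
    -- the continued loop, which is charged even on lists where the loop stops.
    have hle : ∀ Rs, (afterRound Rs).toOuterMeasure {LB | 0 < LB ∧ LB ≤ I.opt}ᶜ ≤
        (I.overestimated p (i + 1)).indicator 1 Rs +
          (I.lbLoop p r (i + 1 + 1) Rs).toOuterMeasure {LB | 0 < LB ∧ LB ≤ I.opt}ᶜ := by
      intro Rs
      by_cases hRs : Rs ∈ I.overestimated p (i + 1)
      · rw [Set.indicator_of_mem hRs]
        exact (PMF.toOuterMeasure_le_one _ _).trans (self_le_add_right _ _)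
      · simp only [hafterRound]
        split_ifs with hif
        · have hmem := hF.proxGrad_mem hx0 Rs (p.eps * I.guess (i + 1) / 3)
          have he : 0 < 1 + epsPrime p + p.eps / 3 := by
            have := epsPrime_pos heps
            positivity
          have hlt : ∀ y ∈ I.feasible, I.gHat Rs y + I.s y <
              (1 + epsPrime p + p.eps / 3) * max I.opt (I.guess (i + 1)) := fun y hy => by
            by_contra hcon
            exact hRs ⟨y, hy, not_lt.1 hcon⟩
          have h1 := hlt _ hmem
          have hgood : 0 < (I.gHat Rs (I.proxGrad p Rs (p.eps * I.guess (i + 1) / 3)) +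
                I.s (I.proxGrad p Rs (p.eps * I.guess (i + 1) / 3))) /
                  (1 + epsPrime p + p.eps / 3) ∧
              (I.gHat Rs (I.proxGrad p Rs (p.eps * I.guess (i + 1) / 3)) +
                I.s (I.proxGrad p Rs (p.eps * I.guess (i + 1) / 3))) /
                  (1 + epsPrime p + p.eps / 3) ≤ I.opt := by
            constructor
            · exact div_pos ((mul_pos he (hF.guess_pos hk _)).trans_le hif) he
            -- If the guess is at least `OPT`, the absence of overestimation makes the test fail;
            -- otherwise it bounds `LB` by `OPT`.
            · rcases le_total I.opt (I.guess (i + 1)) with h | h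
              · rw [max_eq_right h] at h1
                exact absurd hif (not_le.2 h1)
              · rw [max_eq_left h] at h1
                rw [div_le_iff₀ he]
                linarith
          rw [PMF.toOuterMeasure_pure_apply, if_neg (by simpa using hgood)]
          exact zero_le
        · exact self_le_add_left _ _
    refine (PMF.expect_mono _ fun Rs _ => hle Rs).trans ?_
    rw [PMF.expect_add, ← PMF.toOuterMeasure_eq_expect]
    have h1 := hF.overestimated_le hI hLh hk heps hr i.succ_ne_zero
    have h2 := ih (i + 1) (by omega)
    push_cast
    rw [add_mul, one_mul, add_comm]
    exact add_le_add h2 h1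

/-- The estimate `LB` is a positive lower bound on the optimum with high probability. -/
theorem IsFeasibleSetting.lbLoop_le (hF : I.IsFeasibleSetting p.Lc)
    (hI : I.IsRegular p.Lh p.βh) (hx0 : p.x0 ∈ I.feasible) (hLh : 0 < p.Lh) (hk : 0 ≤ I.k)
    (hopt : 1 ≤ I.opt) (heps : 0 < p.eps) (hell : 0 < p.ell) :
    (I.lbLoop p I.rounds 1 []).toOuterMeasure {LB | 0 < LB ∧ LB ≤ I.opt}ᶜ ≤
      ENNReal.ofReal (1 / (2 * (Fintype.card V : ℝ) ^ p.ell)) := by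
  have h := hF.expect_lbLoop_le hI hx0 hLh hk hopt heps hell I.rounds 0 le_rfl
  rw [show I.theta p 0 = 0 from if_pos rfl, TriggeringModel.rrSamples, PMF.expect_pure] at h
  refine h.trans ?_
  rcases Nat.eq_zero_or_pos I.rounds with h0 | h0
  · simp [h0]
  have h2 := two_pos.trans_le (two_le_logb_of_rounds_pos h0)
  have hn := Real.rpow_pos_of_pos (one_pos.trans_le (one_le_card_real (V := V))) p.ell
  rw [← ENNReal.ofReal_natCast, ← ENNReal.ofReal_mul (Nat.cast_nonneg _)]
  refine ENNReal.ofReal_le_ofReal ?_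
  rw [mul_one_div, div_le_div_iff₀ (by positivity) (by positivity), one_mul, mul_comm]
  exact mul_le_mul_of_nonneg_left (rounds_le_logb h0) (by positivity)

end LowerBoundLoop

end CIMBS

theorem Real.exp_neg_le_one_div_of_log_le {C E : ℝ} (hC : 0 < C) (h : Real.log C ≤ E) :
    Real.exp (-E) ≤ 1 / C := by
  rw [one_div, ← Real.exp_log (inv_pos.2 hC), Real.log_inv]
  exact Real.exp_le_exp.2 (neg_le_neg h)

/-! ### The final phase and the theorem -/

namespace CIMBS

variable {V : Type*} [Fintype V] [DecidableEq V] [Nonempty V] {d : ℕ} {I : CIMBS V d}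
  {p : ProxGradInput d}

section FinalPhase

theorem betaHat_pos (hLh : 0 < p.Lh) {Rs : List (Finset V)} (hne : Rs ≠ [])
    (hRs : ∀ R ∈ Rs, R.Nonempty) : 0 < betaHat p Rs := by
  have hn : (0 : ℝ) < Fintype.card V := one_pos.trans_le one_le_card_real
  have hlen : (0 : ℝ) < Rs.length := Nat.cast_pos.2 (List.length_pos_iff.2 hne)
  have hL : (0 : ℝ) < p.Lh := hLh
  have h2 : 0 < nu 2 Rs := by
    refine div_pos (List.sum_pos _ (fun a ha => ?_) (by simpa using hne)) hlen
    obtain ⟨R, hR, rfl⟩ := List.mem_map.1 ha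
    have : (0 : ℝ) < R.card := Nat.cast_pos.2 (hRs R hR).card_pos
    positivity
  have h1 : 0 ≤ nu 1 Rs := by
    refine div_nonneg (List.sum_nonneg fun a ha => ?_) hlen.le
    obtain ⟨R, hR, rfl⟩ := List.mem_map.1 ha
    positivity
  have h3 : (0 : ℝ) ≤ p.βh := p.βh.2
  unfold betaHat
  positivity

set_option maxHeartbeats 1000000 in
/-- With a correct estimate `LB`, the proximal gradient algorithm on the final RR sets succeeds with
high probability. -/
theorem IsFeasibleSetting.rrSamples_proxGrad_le (hF : I.IsFeasibleSetting p.Lc)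
    (hI : I.IsRegular p.Lh p.βh) (hx0 : p.x0 ∈ I.feasible)
    (hΔ : ∀ x ∈ I.feasible, ∀ y ∈ I.feasible, dist x y ≤ p.Δ)
    (hLh : 0 < p.Lh) (heps : 0 < p.eps) (heps2 : p.eps < 1 / 2)
    (hell : 0 < p.ell) {LB : ℝ} (hLB : 0 < LB) (hLBopt : LB ≤ I.opt) :
    (I.model.rrSamples ⌈max (theta1 V p (1 / 2) LB) (I.theta2 p (1 / 2) LB)⌉₊).toOuterMeasure
        {Rs | ¬ (1 / 2 - p.eps) * I.opt ≤
          I.g (I.proxGrad p Rs (p.eps * LB)) + I.s (I.proxGrad p Rs (p.eps * LB))} ≤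
      ENNReal.ofReal (1 / (2 * (Fintype.card V : ℝ) ^ p.ell)) := by
  set m := ⌈max (theta1 V p (1 / 2) LB) (I.theta2 p (1 / 2) LB)⌉₊ with hm
  set n : ℝ := (Fintype.card V : ℝ) with hn
  set u := p.eps / 3 with hu
  set α' := 1 / 2 - u with hα
  set b := u - 1 / 4 * α' ^ 2 * u with hb
  set K := I.covNum (u / (I.lip p + I.lip p) * LB) with hK
  set C := 4 * n ^ p.ell with hC
  have heu : p.eps = 3 * u := by rw [hu]; ring
  have hu0 : 0 < u := by positivity
  have hu6 : u < 1 / 6 := by linarith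
  have hα3 : 1 / 3 < α' := by linarith
  have hα2 : α' < 1 / 2 := by linarith
  have hαsq : α' ^ 2 ≤ α' / 2 := by nlinarith
  have hb0 : 0 < b := by
    have : b = u * (1 - 1 / 4 * α' ^ 2) := by rw [hb]; ring
    rw [this]
    exact mul_pos hu0 (by linarith)
  have hbu : b ≤ u := by
    have : 0 ≤ 1 / 4 * α' ^ 2 * u := by positivity
    linarith
  have hn0 : 0 < n := one_pos.trans_le one_le_card_real
  have hopt0 : 0 < I.opt := hLB.trans_le hLBopt
  have hlip := hF.lip_pos hLh
  have hr0 : 0 < u / (I.lip p + I.lip p) * LB := by positivity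
  have hK1 : 1 ≤ K := hF.one_le_covNum hr0
  have hC4 : 4 ≤ C := by
    have : (1 : ℝ) ≤ n ^ p.ell := Real.one_le_rpow one_le_card_real hell.le
    linarith
  have hC0 : 0 < C := by linarith
  have hm1 : 8 * n * Real.log C ≤ m * (LB * α' ^ 2 * u ^ 2) := by
    have h1 : theta1 V p (1 / 2) LB ≤ m := (le_max_left _ _).trans (Nat.le_ceil _)
    have h2 : theta1 V p (1 / 2) LB = 8 * n * Real.log C / (LB * α' ^ 2 * u ^ 2) := by
      rw [theta1]
      congr 1
      rw [hα, hu]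
      ring
    rwa [h2, div_le_iff₀ (by positivity)] at h1
  have hm2 : 2 * α' * n * Real.log (C * K) ≤ m * (b ^ 2 * LB) := by
    have h1 : I.theta2 p (1 / 2) LB ≤ m := (le_max_right _ _).trans (Nat.le_ceil _)
    have h2 : I.theta2 p (1 / 2) LB = 2 * α' * n * Real.log (C * K) / (b ^ 2 * LB) := rfl
    rwa [h2, div_le_iff₀ (by positivity)] at h1
  have hmpos : m ≠ 0 := by
    intro h0
    rw [h0, Nat.cast_zero, zero_mul] at hm1
    have := Real.log_pos (by linarith : 1 < C)
    have : 0 < 8 * n * Real.log C := by positivity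
    linarith
  obtain ⟨z0, hz0, hz0opt, hopt⟩ := hF.exists_isMax hI
  obtain ⟨N, hN, hcard, hnet⟩ := hF.exists_net hr0
  -- Only net points near a bad output matter. Restricting the union bound to them lowers the
  -- variance proxy, which is why `θ^{(2)}` carries the factor `α'`.
  set N' := N.filter fun z => I.g z ≤ (1 / 2 - 5 / 2 * u) * I.opt with hN'
  -- This is the relative deviation for which `θ^{(1)}` gives failure probability at most `1 / C` in
  -- the lower tail at the optimum.
  set a := u * α' / 2 with ha
  have ha0 : 0 < a := by positivity
  have hlow : (I.model.rrSamples m).toOuterMeasure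
      {l | I.gHat l z0 ≤ I.g z0 - a * I.opt} ≤ ENNReal.ofReal (1 / C) := by
    have hg : I.g z0 ≤ I.opt := by linarith [hF.s_nonneg hz0]
    refine (hI.gHat_lower_tail (hF.nonneg hz0) hg hopt0 (by positivity)).trans
      (ENNReal.ofReal_le_ofReal ?_)
    refine Real.exp_neg_le_one_div_of_log_le hC0 ?_
    rw [le_div_iff₀ (by positivity)]
    have h1 : (m : ℝ) * (LB * α' ^ 2 * u ^ 2) ≤ m * (I.opt * α' ^ 2 * u ^ 2) := by gcongr
    have h2 := mul_le_mul_of_nonneg_right (hm1.trans h1) hopt0.le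
    have h3 : (m : ℝ) * (a * I.opt) ^ 2 = m * (I.opt * α' ^ 2 * u ^ 2) * I.opt / 4 := by
      rw [ha]
      ring
    rw [h3]
    linarith
  have hup : (I.model.rrSamples m).toOuterMeasure
      {l | ∃ z ∈ N', l ∈ {l | I.g z + b * I.opt ≤ I.gHat l z}} ≤ ENNReal.ofReal (1 / C) := by
    calc (I.model.rrSamples m).toOuterMeasure
          {l | ∃ z ∈ N', l ∈ {l | I.g z + b * I.opt ≤ I.gHat l z}}
        ≤ N'.card * ENNReal.ofReal (1 / (C * K)) := by
          refine PMF.toOuterMeasure_exists_mem_le _ _ _ fun z hz => ?_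
          obtain ⟨hzN, hzg⟩ := Finset.mem_filter.1 hz
          have hG0 : 0 < (1 / 2 - 5 / 2 * u) * I.opt := mul_pos (by linarith) hopt0
          refine (hI.gHat_upper_tail (hF.nonneg (hN z hzN)) m hzg hG0 (by positivity)).trans
            (ENNReal.ofReal_le_ofReal ?_)
          have hCK : 0 < C * K := by positivity
          refine Real.exp_neg_le_one_div_of_log_le hCK ?_
          rw [le_div_iff₀ (by positivity)]
          -- Up to the factor `OPT`, the left side is at most `1 - 5u + 2u/3`, using `b ≤ u`, and
          -- the right side is `1 - 2u`.
          have hden : 2 * ((1 / 2 - 5 / 2 * u) * I.opt) + 2 / 3 * (b * I.opt) ≤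
              2 * α' * I.opt := by
            rw [hα]
            nlinarith [mul_le_mul_of_nonneg_right hbu hopt0.le, mul_pos hu0 hopt0]
          have hlog : 0 ≤ Real.log (C * K) := Real.log_nonneg (by nlinarith)
          calc Real.log (C * K) *
                (n * (2 * ((1 / 2 - 5 / 2 * u) * I.opt) + 2 / 3 * (b * I.opt)))
              ≤ Real.log (C * K) * (n * (2 * α' * I.opt)) := by gcongr
            _ = 2 * α' * n * Real.log (C * K) * I.opt := by ring
            _ ≤ m * (b ^ 2 * LB) * I.opt := by gcongr
            _ ≤ m * (b ^ 2 * I.opt) * I.opt := by gcongr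
            _ = m * (b * I.opt) ^ 2 := by ring
      _ ≤ ENNReal.ofReal K * ENNReal.ofReal (1 / (C * K)) := by
          gcongr
          rw [← ENNReal.ofReal_natCast]
          refine ENNReal.ofReal_le_ofReal (le_trans ?_ hcard)
          exact_mod_cast Finset.card_filter_le _ _
      _ = ENNReal.ofReal (1 / C) := by
          rw [← ENNReal.ofReal_mul (by linarith)]
          congr 1
          have : K ≠ 0 := by linarith
          field_simp
  have hsum : ENNReal.ofReal (1 / (2 * n ^ p.ell)) =
      ENNReal.ofReal (1 / C) + ENNReal.ofReal (1 / C) := by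
    rw [← ENNReal.ofReal_add (by positivity) (by positivity)]
    congr 1
    have : 0 < n ^ p.ell := Real.rpow_pos_of_pos hn0 _
    rw [hC]
    field_simp
    norm_num
  rw [hsum]
  refine le_trans ?_ ((MeasureTheory.measure_union_le _ _).trans (add_le_add hlow hup))
  refine PMF.toOuterMeasure_mono _ ?_
  rintro Rs ⟨hbad, hsupp⟩
  by_contra hgood
  simp only [Set.mem_union, Set.mem_ofPred_eq, not_or, not_le, not_exists, not_and] at hgood hbad
  obtain ⟨hA, hB⟩ := hgood
  have hβ : 0 < betaHat p Rs := betaHat_pos hLh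
    (fun h0 => hmpos (by rw [← I.model.length_of_mem_support_rrSamples hsupp, h0]; rfl))
    fun R hR => I.model.nonempty_of_mem_of_mem_support_rrSamples hsupp hR
  have hprox := hF.half_sub_le_proxGrad hI hx0 hΔ hβ (mul_pos heps hLB) hz0
  have hmem := hF.proxGrad_mem hx0 Rs (p.eps * LB)
  set x := I.proxGrad p Rs (p.eps * LB)
  obtain ⟨z, hz, hxz⟩ := hnet x hmem
  have hd : I.lip p * ‖x - z‖ ≤ u / 2 * LB := by
    refine (mul_le_mul_of_nonneg_left hxz hlip.le).trans (le_of_eq ?_)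
    field_simp
    ring
  have h1 := hF.g_add_s_le hI (hN z hz) hmem
  rw [norm_sub_rev] at h1
  have h2 := hF.gHat_add_s_le hI Rs hmem (hN z hz)
  have huLB : u * LB ≤ u * I.opt := by gcongr
  rw [heu] at hbad hprox
  -- A bad output has value below `(1/2 - 3u) OPT`, and the net point is worth at most `u/2 * LB`
  -- more.
  have hzN' : z ∈ N' := Finset.mem_filter.2 ⟨hz, by linarith [hF.s_nonneg (hN z hz)]⟩
  -- The estimated value of the output is now below `(1/2 - 2u + b) OPT`, while the optimiser
  -- guarantees at least `(1/2 - a/2 - 5u/6) OPT`. These are incompatible when `b ≤ 7u/6 - a/2`.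
  -- With `u` in place of `5u/6`, the condition would be `b ≤ u - a/2`, which fails for the given
  -- `b`.
  have h3 := hB z hzN'
  have h4 : b ≤ (7 / 6 * u - a / 2) := by
    have h6 : u * α' ≤ u * (1 / 2) := mul_le_mul_of_nonneg_left hα2.le hu0.le
    have h7 : 0 ≤ 1 / 4 * α' ^ 2 * u := by positivity
    rw [hb, ha]
    linarith
  have h5 := mul_le_mul_of_nonneg_right h4 hopt0.le
  linarith

end FinalPhase

theorem IsFeasibleSetting.le_proxGradRIS (hF : I.IsFeasibleSetting p.Lc)
    (hI : I.IsRegular p.Lh p.βh) (hx0 : p.x0 ∈ I.feasible)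
    (hΔ : ∀ x ∈ I.feasible, ∀ y ∈ I.feasible, dist x y ≤ p.Δ)
    (hLh : 0 < p.Lh) (hk : 0 ≤ I.k) (hopt : 1 ≤ I.opt) (heps : 0 < p.eps) (hell : 0 < p.ell) :
    ENNReal.ofReal (1 - 1 / (Fintype.card V : ℝ) ^ p.ell) ≤
      (I.proxGradRIS p).toOuterMeasure
        {x | x ∈ I.feasible ∧ (1 / 2 - p.eps) * I.opt ≤ I.g x + I.s x} := by
  set good := {x | x ∈ I.feasible ∧ (1 / 2 - p.eps) * I.opt ≤ I.g x + I.s x} with hgood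
  set n : ℝ := (Fintype.card V : ℝ) with hn
  have hnell : 0 < n ^ p.ell := Real.rpow_pos_of_pos (one_pos.trans_le one_le_card_real) _
  set q := ENNReal.ofReal (1 / (2 * n ^ p.ell)) with hq
  have hfinal : ∀ LB, 0 < LB ∧ LB ≤ I.opt →
      (I.model.rrSamples ⌈max (theta1 V p (1 / 2) LB) (I.theta2 p (1 / 2) LB)⌉₊).toOuterMeasure
        {Rs | I.proxGrad p Rs (p.eps * LB) ∈ goodᶜ} ≤ q := by
    rintro LB ⟨hLB, hLBopt⟩
    -- For `ε ≥ 1/2` the required value is at most zero, so every feasible output is good; this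
    -- includes the cases where a sample size has denominator zero.
    rcases lt_or_ge p.eps (1 / 2) with h2 | h2
    · refine le_trans (MeasureTheory.measure_mono fun Rs hRs => ?_)
        (hF.rrSamples_proxGrad_le hI hx0 hΔ hLh heps h2 hell hLB hLBopt)
      exact fun h => hRs ⟨hF.proxGrad_mem hx0 _ _, h⟩
    · have hempty : {Rs | I.proxGrad p Rs (p.eps * LB) ∈ goodᶜ} = ∅ := by
        refine Set.eq_empty_of_forall_notMem fun Rs hRs => hRs ?_
        have hmem := hF.proxGrad_mem hx0 Rs (p.eps * LB)
        refine ⟨hmem, ?_⟩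
        have h3 := hI.g_nonneg (hF.nonneg hmem)
        have h4 := hF.s_nonneg hmem
        nlinarith
      rw [hempty, MeasureTheory.measure_empty]
      exact zero_le
  have hbad : (I.proxGradRIS p).toOuterMeasure goodᶜ ≤ ENNReal.ofReal (1 / n ^ p.ell) := by
    have hexp : (I.proxGradRIS p).toOuterMeasure goodᶜ =
        (I.lbLoop p I.rounds 1 []).expect fun LB =>
          (I.model.rrSamples ⌈max (theta1 V p (1 / 2) LB)
            (I.theta2 p (1 / 2) LB)⌉₊).toOuterMeasure
              {Rs | I.proxGrad p Rs (p.eps * LB) ∈ goodᶜ} := by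
      rw [proxGradRIS, sampling, PMF.toOuterMeasure_map_apply, PMF.toOuterMeasure_bind_eq_expect]
      simp only [PMF.toOuterMeasure_map_apply]
      rfl
    rw [hexp]
    calc _ ≤ (I.lbLoop p I.rounds 1 []).expect fun LB =>
            ({LB | 0 < LB ∧ LB ≤ I.opt}ᶜ : Set ℝ).indicator 1 LB + q := by
          refine PMF.expect_mono _ fun LB _ => ?_
          by_cases hLB : 0 < LB ∧ LB ≤ I.opt
          · exact (hfinal LB hLB).trans (self_le_add_left _ _)
          · rw [Set.indicator_of_mem (show LB ∈ {LB | 0 < LB ∧ LB ≤ I.opt}ᶜ from hLB)]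
            exact (PMF.toOuterMeasure_le_one _ _).trans (self_le_add_right _ _)
      _ ≤ q + q := by
          rw [PMF.expect_add, ← PMF.toOuterMeasure_eq_expect, PMF.expect_const]
          exact add_le_add (hF.lbLoop_le hI hx0 hLh hk hopt heps hell) le_rfl
      _ = _ := by
          rw [hq, ← ENNReal.ofReal_add (by positivity) (by positivity)]
          congr 1
          field_simp
          norm_num
  rw [ENNReal.ofReal_sub _ (by positivity), ENNReal.ofReal_one, tsub_le_iff_right,
    ← (I.proxGradRIS p).toOuterMeasure_add_compl good]
  gcongr

end CIMBS

theorem theorem3 {V : Type*} [Fintype V] [DecidableEq V] [Nonempty V] {d : ℕ}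
    (I : CIMBS V d) (p : ProxGradInput d)
    -- activation functions `h_v : ℝ_+^d → [0,1]`
    (h_range : ∀ v, ∀ x ∈ nonnegOrthant d, I.h v x ∈ Set.Icc (0 : ℝ) 1)
    (h_mono : ∀ v, IsMonotoneOn (nonnegOrthant d) (I.h v))
    (h_dr : ∀ v, IsDRSubmodularOn (nonnegOrthant d) (I.h v))
    (h_lip : ∀ v, LipschitzOnWith p.Lh (I.h v) (nonnegOrthant d))
    (h_smooth : ∀ v, IsSmoothOn p.βh (nonnegOrthant d) (I.h v))
    (hLh : 0 < p.Lh)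
    -- convex domain, convex Lipschitz cost, budget, balance parameter
    (hD : I.domain ⊆ nonnegOrthant d)
    (hc_convex : ConvexOn ℝ I.domain I.c)
    (hc_lip : LipschitzOnWith p.Lc I.c I.domain)
    (hk : 0 ≤ I.k) (hlam : 0 ≤ I.lam)
    (hcompact : IsCompact I.feasible)
    -- `Δ` bounds the diameter, the starting point is feasible
    (hΔ : ∀ x ∈ I.feasible, ∀ y ∈ I.feasible, dist x y ≤ p.Δ)
    (hx0 : p.x0 ∈ I.feasible)
    -- `1`, the initial value of the estimate `LB`, is a lower bound on the optimum
    (hopt : 1 ≤ I.opt)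
    (heps : 0 < p.eps) (hell : 0 < p.ell) :
    ENNReal.ofReal (1 - 1 / (Fintype.card V : ℝ) ^ p.ell) ≤
      (I.proxGradRIS p).toOuterMeasure
        {x | x ∈ I.feasible ∧ (1 / 2 - p.eps) * I.opt ≤ I.g x + I.s x} :=
  CIMBS.IsFeasibleSetting.le_proxGradRIS ⟨hD, hc_convex, hc_lip, hlam, hcompact, ⟨p.x0, hx0⟩⟩
    ⟨h_range, h_mono, h_dr, h_lip, h_smooth⟩ hx0 hΔ hLh hk hopt heps hell
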